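/- \textbf{Setting.} For $z\in\mathbb R$ let $\xi(z)=\cos\sqrt{|z|}$ if $z\le 0$, $\xi(z)=\cosh\sqrt z$ if $z>0$, and $\eta_0(z)=\sin\sqrt{|z|}/\sqrt{|z|}$ if $z<0$, $\eta_0(0)=1$, $\eta_0(z)=\sinh\sqrt z/\sqrt z$ if $z>0$. Let $E\in\mathbb R$, and let $J$ be the closed interval with endpoints $x_i$ and $x_f$ (in either order), in whose interior the $n\times n$ potential has a constant value $V_0=D\,V_0^D D^T$ with $D$ real orthogonal and $V_0^D=\mathrm{diag}(v_1,\dots,v_n)$. Let the real $n\times n$ matrix function $Y$ solve $Y''=(V_0-E I)Y$ in the interior of $J$, with $Y,Y'$ continuous on $J$, $Y'(x_i)$ invertible and $Y(x_i)Y'(x_i)^{-1}$ symmetric. Put $\Psi=Y(Y')^{-1}$ and $\Psi^D=D^{-1}\Psi D$ wherever $Y'$ is invertible. For $\delta=x-x_i$ write $\xi$ and $\eta_0$ for the diagonal matrices with entries $\xi((v_k-E)\delta^2)$ and $\eta_0((v_k-E)\delta^2)$, put $F(x)=\delta\,\xi^{-1}\eta_0$ wherever $\xi$ is invertible, and $$\Omega(x)=\bigl[\xi-\delta\eta_0\Psi^D(x_i)\bigr]^{-1}\bigl[\xi\,\Psi^D(x_i)+\delta\eta_0\bigr]$$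 wherever $\xi-\delta\eta_0\Psi^D(x_i)$ is invertible. \textbf{Phase angles.} Phase angles on $J$ of a matrix function $M$ (defined on part of $J$) are continuous functions $\phi_1,\dots,\phi_n:J\to\mathbb R$ with $\phi_1\le\dots\le\phi_n\le\phi_1+\pi$ on $J$, such that at every point of $J$ at which $M$ is defined the eigenvalues of $M$, with multiplicity, are the finite numbers $\tan\phi_1,\dots,\tan\phi_n$; and $S(M(x))=\sum_j\phi_j(x)$. \textbf{Theorem.} (a) Every choice of numbers $\phi_1(x_i)\le\dots\le\phi_n(x_i)\le\phi_1(x_i)+\pi$ such that the eigenvalues of $\Psi^D(x_i)$ are $\tan\phi_j(x_i)$ extends to phase angles of $\Psi^D$ on $J$; and $F$ has phase angles on $J$ all equal to $0$ at $x_i$. (b) At every $x\in J$ where $\Psi^D(x)$ is defined, its eigenvalues can be written, with multiplicity, as $\tan\rho_j$ with $\rho_j\in[0,\pi)$, and at every $x\in J$ where $\Omega(x)$ is defined, its eigenvalues can be written, with algebraic multiplicity, as $\tan\tau_j$ with $\tau_j\in[0,\pi)$, $j=1,\dots,n$. (c) Let $\phi_j$ be any phase angles of $\Psi^D$ on $J$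 and $\theta_j$ any phase angles of $F$ on $J$ vanishing at $x_i$, and use them in $S(\Psi^D(x))=\sum_j\phi_j(x)$ and $S(\delta\,\xi^{-1}\eta_0)=\sum_j\theta_j(x)$. Then at every $x\in J$ where $\Psi^D(x)$ and $\Omega(x)$ are both defined, for all $\rho_j,\tau_j$ as in (b), $$S(\Psi^D(x))=S(\Psi^D(x_i))+S(\delta\,\xi^{-1}\eta_0)+\sum_{j=1}^n(\rho_j-\tau_j).$$ Consequently the net number of multiples of $\pi$ passed by the phase angles over the step is $$\sum_{j=1}^n\Bigl(\Bigl\lfloor\tfrac{\phi_j(x)}{\pi}\Bigr\rfloor-\Bigl\lfloor\tfrac{\phi_j(x_i)}{\pi}\Bigr\rfloor\Bigr)=\frac1\pi\Bigl(S(\Psi^D(x_i))+S(\delta\,\xi^{-1}\eta_0)-\sum_{j=1}^n\tau_j\Bigr)-\sum_{j=1}^n\Bigl\lfloor\tfrac{\phi_j(x_i)}{\pi}\Bigr\rfloor .$$ -/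

import Mathlib

open Set Matrix Polynomial

noncomputable section

namespace CoupledChannel

/-- The function `ξ`: `cos √|z|` for `z ≤ 0` and `cosh √z` for `z > 0`. -/
def xiFun (z : ℝ) : ℝ :=
  if z ≤ 0 then Real.cos (Real.sqrt |z|) else Real.cosh (Real.sqrt z)

/-- The function `η₀`: `sin √|z| / √|z|` for `z < 0`, `1` at `z = 0`, `sinh √z / √z` for `z > 0`. -/
def etaZero (z : ℝ) : ℝ :=
  if z < 0 then Real.sin (Real.sqrt |z|) / Real.sqrt |z|
  else if z = 0 then 1
  else Real.sinh (Real.sqrt z) / Real.sqrt z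

variable {n : ℕ}

/-- The diagonal matrix `ξ(Z(δ))`, where `Z(δ) = (diag v - E I) δ²`. -/
def xiMat (v : Fin n → ℝ) (E δ : ℝ) : Matrix (Fin n) (Fin n) ℝ :=
  diagonal fun k => xiFun ((v k - E) * δ ^ 2)

/-- The diagonal matrix `η₀(Z(δ))`, where `Z(δ) = (diag v - E I) δ²`. -/
def etaMat (v : Fin n → ℝ) (E δ : ℝ) : Matrix (Fin n) (Fin n) ℝ :=
  diagonal fun k => etaZero ((v k - E) * δ ^ 2)

/-- The pair `(Y, dY)` is a matrix solution, with its derivative, of `Y'' = (V - E I) Y` across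
the interval with endpoints `x₀` and `x₁` (in either order). Derivatives are taken entrywise, in
the open interval; `Y` and `Y'` are continuous up to the endpoints. -/
structure IsSolution (V : ℝ → Matrix (Fin n) (Fin n) ℝ) (E x₀ x₁ : ℝ)
    (Y dY : ℝ → Matrix (Fin n) (Fin n) ℝ) : Prop where
  continuousOn : ContinuousOn Y (uIcc x₀ x₁)
  continuousOn_deriv : ContinuousOn dY (uIcc x₀ x₁)
  hasDerivAt : ∀ t ∈ uIoo x₀ x₁, ∀ j k,
    HasDerivAt (fun s => Y s j k) (dY t j k) t
  hasDerivAt_deriv : ∀ t ∈ uIoo x₀ x₁, ∀ j k,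
    HasDerivAt (fun s => dY s j k) (((V t - E • (1 : Matrix (Fin n) (Fin n) ℝ)) * Y t) j k) t

/-- `Ψ = Y (Y')⁻¹`, meaningful where `Y'` is invertible. -/
def psi (Y dY : ℝ → Matrix (Fin n) (Fin n) ℝ) (t : ℝ) : Matrix (Fin n) (Fin n) ℝ :=
  Y t * (dY t)⁻¹

/-- `Ψᴰ = D⁻¹ Ψ D`, the matrix `Ψ` in the diagonalized representation. -/
def psiD (D : Matrix (Fin n) (Fin n) ℝ) (Y dY : ℝ → Matrix (Fin n) (Fin n) ℝ) (t : ℝ) :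
    Matrix (Fin n) (Fin n) ℝ :=
  D⁻¹ * psi Y dY t * D

/-- The matrix `ξ - δ η₀ P`, whose inverse enters `Ω`. -/
def omegaDen (v : Fin n → ℝ) (E δ : ℝ) (P : Matrix (Fin n) (Fin n) ℝ) :
    Matrix (Fin n) (Fin n) ℝ :=
  xiMat v E δ - δ • etaMat v E δ * P

/-- `Ω = (ξ - δ η₀ P)⁻¹ (ξ P + δ η₀)`, where `P` is the value of `Ψᴰ` at the start of the step. -/
def omega (v : Fin n → ℝ) (E δ : ℝ) (P : Matrix (Fin n) (Fin n) ℝ) :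
    Matrix (Fin n) (Fin n) ℝ :=
  (omegaDen v E δ P)⁻¹ * (xiMat v E δ * P + δ • etaMat v E δ)

/-- `δ ξ⁻¹ η₀`, meaningful where `ξ` is invertible. -/
def fMat (v : Fin n → ℝ) (E δ : ℝ) : Matrix (Fin n) (Fin n) ℝ :=
  δ • ((xiMat v E δ)⁻¹ * etaMat v E δ)

/-- The eigenvalues of `M`, with algebraic multiplicity, are `tan (α j)`, `j = 1, …, n`
(where each `tan (α j)` is a genuine, finite tangent). -/
def EigenvaluesAreTan (M : Matrix (Fin n) (Fin n) ℝ) (α : Fin n → ℝ) : Prop :=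
  (∀ j, Real.cos (α j) ≠ 0) ∧ M.charpoly = ∏ j, (X - C (Real.tan (α j)))

/-- The ordering condition `α₁ ≤ α₂ ≤ … ≤ αₙ ≤ α₁ + π`. -/
def AnglesOrdered (α : Fin n → ℝ) : Prop :=
  Monotone α ∧ ∀ j k, α j ≤ α k + Real.pi

/-- `φ` is a family of phase angles on `I` of the matrix function `M`, which is defined at the
points of `R`: continuous on all of `I` (hence also through the singularities of `M`), ordered, and
such that the eigenvalues of `M t` are `tan (φ t j)` wherever `M t` is defined. -/
structure IsPhaseAngles (M : ℝ → Matrix (Fin n) (Fin n) ℝ) (R I : Set ℝ)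
    (φ : ℝ → Fin n → ℝ) : Prop where
  continuousOn : ContinuousOn φ I
  ordered : ∀ t ∈ I, AnglesOrdered (φ t)
  eigenvalues : ∀ t ∈ I, t ∈ R → EigenvaluesAreTan (M t) (φ t)

/-- `φ` is a family of phase angles of `Ψᴰ` across the step; `Ψᴰ` is defined where `Y'` is
invertible. -/
def IsPsiPhase (D : Matrix (Fin n) (Fin n) ℝ) (Y dY : ℝ → Matrix (Fin n) (Fin n) ℝ)
    (x₀ x₁ : ℝ) (φ : ℝ → Fin n → ℝ) : Prop :=
  IsPhaseAngles (psiD D Y dY) {t | IsUnit (dY t)} (uIcc x₀ x₁) φ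

/-- `θ` is a family of phase angles of `δ ξ⁻¹ η₀`, `δ = t - x₀`, across the step, all starting
from `0`; the matrix is defined where `ξ` is invertible. -/
def IsFPhase (v : Fin n → ℝ) (E x₀ x₁ : ℝ) (θ : ℝ → Fin n → ℝ) : Prop :=
  IsPhaseAngles (fun t => fMat v E (t - x₀)) {t | IsUnit (xiMat v E (t - x₀))} (uIcc x₀ x₁) θ ∧
    ∀ j, θ x₀ j = 0

/-- The sum `S` of the phase angles at `t`. -/
def phaseSum (φ : ℝ → Fin n → ℝ) (t : ℝ) : ℝ := ∑ j, φ t j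

end CoupledChannel

end

open Set Matrix Polynomial

noncomputable section

namespace CoupledChannel

variable {n : ℕ}

/-! In diagonalized coordinates, replace `Ψᴰ = Y (Y')⁻¹` by the pair `(a, b) = (Y', Y)`, which stays
regular where `Y'` is singular. Symmetry of the initial value makes the pair Lagrangian, `aᵀ b = bᵀ
a`, so `(a - i b)⁻¹ (a + i b)` has unimodular eigenvalues `e^{2iα_j}`, and the `α_j` modulo `π` are
the phase angles. Ordered angles of spread at most `π` are determined by their classes modulo `π`
and their sum (`AnglesOrdered.eq_of_perm`), while twice the sum is an argument of `det (a + i b) /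
det (a - i b)`. A continuous argument over a simply connected parameter space therefore yields
continuous ordered phases (`exists_continuous_phases`). This gives (a), `F` being the case of zero
initial value.

For (c), a homotopy with parameter `λ` joins `(Y', Y)` at `λ = 0` to a pair with the phases of `Ω`
at `λ = 1`. It changes the second member only by an invertible diagonal factor, so the number of
phases that are multiples of `π` is constant and none is crossed: the sums of floors agree at both
ends (`sum_floor_homotopy_eq`). A phase sum exceeds the sum of the representatives in `[0, π)` by
`π` times the sum of floors (`HasPhases.sum_sub_sum`), so the two phase sums differ by `∑ (ρ_j -
τ_j)`. At `λ = 1` the factorization `(1 + iF)(1 + iP) = (1 - FP) + i(F + P)` (`det_addition`) gives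
the phase sum `S(F) + S(P)` modulo `π`, and continuity from `δ = 0` removes the ambiguity. -/

/-- A real matrix seen as a complex one. -/
abbrev toC : Matrix (Fin n) (Fin n) ℝ →+* Matrix (Fin n) (Fin n) ℂ := Complex.ofRealHom.mapMatrix

/-- The unit complex number `e^{2 i t}`. -/
def expTwo (t : ℝ) : ℂ := Complex.exp (2 * t * Complex.I)

/-- The determinant of `a - i b`. -/
def detMinus (a b : Matrix (Fin n) (Fin n) ℝ) : ℂ := (toC a - Complex.I • toC b).det

/-- The determinant of `a + i b`. -/
def detPlus (a b : Matrix (Fin n) (Fin n) ℝ) : ℂ := (toC a + Complex.I • toC b).det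

/-- The determinant of `z (a - i b) - (a + i b)`. -/
def pencilDet (a b : Matrix (Fin n) (Fin n) ℝ) (z : ℂ) : ℂ :=
  ((z - 1) • toC a - (Complex.I * (z + 1)) • toC b).det

/-- The eigenvalues of `(a - i b)⁻¹ (a + i b)` are `e^{2 i α j}`. -/
def HasPhases (a b : Matrix (Fin n) (Fin n) ℝ) (α : Fin n → ℝ) : Prop :=
  detMinus a b ≠ 0 ∧ ∀ z, pencilDet a b z = detMinus a b * ∏ j, (z - expTwo (α j))

/-! ### Phases of a pair, modulo `π` -/

lemma expTwo_add (s t : ℝ) : expTwo (s + t) = expTwo s * expTwo t := by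
  simp only [expTwo]; rw [← Complex.exp_add]; congr 1; push_cast; ring

lemma expTwo_eq_iff {s t : ℝ} : expTwo s = expTwo t ↔ ∃ k : ℤ, s = t + k * Real.pi := by
  unfold expTwo
  rw [Complex.exp_eq_exp_iff_exists_int]
  refine exists_congr fun k => ?_
  have h2 : (2 : ℂ) * Complex.I ≠ 0 := by simp
  constructor
  · intro h
    have : (2 * Complex.I) * (s : ℂ) = (2 * Complex.I) * ((t + k * Real.pi : ℝ) : ℂ) := by
      push_cast; linear_combination h
    exact_mod_cast mul_left_cancel₀ h2 this
  · intro h; rw [h]; push_cast; ring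

lemma expTwo_int_mul_pi (k : ℤ) : expTwo (k * Real.pi) = 1 := by
  have : expTwo (k * Real.pi) = expTwo 0 := expTwo_eq_iff.2 ⟨k, by simp⟩
  rw [this]; simp [expTwo]

lemma expTwo_add_pi (t : ℝ) : expTwo (t + Real.pi) = expTwo t :=
  expTwo_eq_iff.2 ⟨1, by simp⟩

lemma expTwo_sub_pi (t : ℝ) : expTwo (t - Real.pi) = expTwo t :=
  expTwo_eq_iff.2 ⟨-1, by simp; ring⟩

lemma expTwo_sum (α : Fin n → ℝ) : expTwo (∑ j, α j) = ∏ j, expTwo (α j) := by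
  simp only [expTwo]; rw [← Complex.exp_sum]; push_cast; rw [Finset.mul_sum, Finset.sum_mul]

@[fun_prop]
lemma continuous_expTwo : Continuous expTwo := by unfold expTwo; fun_prop

lemma expTwo_eq_div (t : ℝ) :
    (Real.cos t - Complex.I * Real.sin t) * expTwo t = Real.cos t + Complex.I * Real.sin t := by
  have h1 : (Real.cos t - Complex.I * Real.sin t : ℂ) = Complex.exp (-(t * Complex.I)) := by
    rw [← neg_mul, Complex.exp_mul_I]; simp; ring
  have h2 : (Real.cos t + Complex.I * Real.sin t : ℂ) = Complex.exp (t * Complex.I) := by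
    rw [Complex.exp_mul_I]; simp; ring
  rw [h1, h2, expTwo, ← Complex.exp_add]; congr 1; ring

lemma cos_sub_I_mul_sin_ne_zero (t : ℝ) : (Real.cos t - Complex.I * Real.sin t : ℂ) ≠ 0 := by
  have h1 : (Real.cos t - Complex.I * Real.sin t : ℂ) = Complex.exp (-(t * Complex.I)) := by
    rw [← neg_mul, Complex.exp_mul_I]; simp; ring
  rw [h1]; exact Complex.exp_ne_zero _

/-- The pencil at `z = 0` is `-(a + i b)`. The phase sum modulo `π` can thus be read off from
determinants. -/
lemma HasPhases.detPlus_eq {a b : Matrix (Fin n) (Fin n) ℝ} {α : Fin n → ℝ}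
    (h : HasPhases a b α) : detPlus a b = detMinus a b * expTwo (∑ j, α j) := by
  have h0 := h.2 0
  have : pencilDet a b 0 = (-1) ^ n * detPlus a b := by
    have : ((0 - 1 : ℂ) • toC a - (Complex.I * (0 + 1)) • toC b) =
        -(toC a + Complex.I • toC b) := by module
    rw [pencilDet, this, det_neg, detPlus]; simp
  rw [this] at h0
  simp only [zero_sub, Finset.prod_neg, Finset.card_univ, Fintype.card_fin] at h0
  rw [expTwo_sum]
  have hn : ((-1 : ℂ) ^ n) ≠ 0 := by simp
  apply mul_left_cancel₀ hn
  rw [h0]; ring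

/-- Equal multisets of roots have equally large fibres over each value; bijections of the fibres
glue to a permutation. -/
lemma exists_perm_of_prod_eq {ι R : Type*} [Fintype ι] [CommRing R] [IsDomain R] {f g : ι → R}
    (h : (∏ j, (X - C (f j))) = ∏ j, (X - C (g j))) : ∃ σ : Equiv.Perm ι, ∀ j, f j = g (σ j) := by
  classical
  have roots_eq : ∀ f : ι → R, (∏ j, (X - C (f j))).roots = Finset.univ.val.map f := fun f => by
    have := Polynomial.roots_multiset_prod_X_sub_C (Finset.univ.val.map f)
    rwa [Multiset.map_map] at this
  have h' : Finset.univ.val.map f = Finset.univ.val.map g := by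
    rw [← roots_eq, ← roots_eq, h]
  have hcard : ∀ c, Nonempty ({j // f j = c} ≃ {j // g j = c}) := fun c => by
    have hc := congrArg (Multiset.count c) h'
    rw [Multiset.count_map, Multiset.count_map] at hc
    refine ⟨Fintype.equivOfCardEq ?_⟩
    rw [Fintype.card_subtype, Fintype.card_subtype]
    simpa [Finset.card_def, Finset.filter_val, eq_comm] using hc
  exact ⟨Equiv.ofFiberEquiv fun c => (hcard c).some, fun j => (Equiv.ofFiberEquiv_map _ j).symm⟩

lemma HasPhases.exists_perm {a b : Matrix (Fin n) (Fin n) ℝ} {α β : Fin n → ℝ}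
    (hα : HasPhases a b α) (hβ : HasPhases a b β) :
    ∃ σ : Equiv.Perm (Fin n), ∀ j, ∃ k : ℤ, α j = β (σ j) + k * Real.pi := by
  have h : (∏ j, (X - C (expTwo (α j)))) = ∏ j, (X - C (expTwo (β j))) := by
    refine Polynomial.funext fun z => ?_
    simp only [eval_prod, eval_sub, eval_X, eval_C]
    exact mul_left_cancel₀ hα.1 ((hα.2 z).symm.trans (hβ.2 z))
  obtain ⟨σ, hσ⟩ := exists_perm_of_prod_eq h
  exact ⟨σ, fun j => expTwo_eq_iff.1 (hσ j)⟩

lemma HasPhases.of_congr {a b : Matrix (Fin n) (Fin n) ℝ} {α β : Fin n → ℝ}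
    (hα : HasPhases a b α) (h : ∀ j, expTwo (α j) = expTwo (β j)) : HasPhases a b β :=
  ⟨hα.1, fun z => by rw [hα.2 z]; simp only [h]⟩

lemma HasPhases.comp_perm {a b : Matrix (Fin n) (Fin n) ℝ} {α : Fin n → ℝ}
    (hα : HasPhases a b α) (σ : Equiv.Perm (Fin n)) : HasPhases a b (α ∘ σ) :=
  ⟨hα.1, fun z => by
    rw [hα.2 z]; congr 1; exact (Equiv.prod_comp σ fun j => z - expTwo (α j)).symm⟩

/-- Both determinants acquire the same factor `det u * det w`. This passes between a pair and the
quotient of its members. -/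
lemma HasPhases.mul_mul {a b : Matrix (Fin n) (Fin n) ℝ} {α : Fin n → ℝ}
    (hα : HasPhases a b α) {u w : Matrix (Fin n) (Fin n) ℝ} (hu : IsUnit u) (hw : IsUnit w) :
    HasPhases (u * a * w) (u * b * w) α := by
  have hu' : (toC u).det ≠ 0 := by
    simpa using ((Matrix.isUnit_iff_isUnit_det _).1 (hu.map toC)).ne_zero
  have hw' : (toC w).det ≠ 0 := by
    simpa using ((Matrix.isUnit_iff_isUnit_det _).1 (hw.map toC)).ne_zero
  have key : ∀ p q : ℂ, (p • toC (u * a * w) - q • toC (u * b * w)) =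
      toC u * (p • toC a - q • toC b) * toC w := by
    intro p q
    simp only [map_mul, Matrix.mul_sub, Matrix.sub_mul, Matrix.mul_smul, Matrix.smul_mul]
  have k1 : detMinus (u * a * w) (u * b * w) = (toC u).det * detMinus a b * (toC w).det := by
    have := key 1 Complex.I
    simp only [one_smul] at this
    rw [detMinus, this, det_mul, det_mul, detMinus]
  refine ⟨?_, fun z => ?_⟩
  · rw [k1]; exact mul_ne_zero (mul_ne_zero hu' hα.1) hw'
  · rw [k1, pencilDet, key, det_mul, det_mul]
    have := hα.2 z
    rw [pencilDet] at this
    rw [this]; ring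

lemma hasPhases_diagonal (α : Fin n → ℝ) :
    HasPhases (diagonal fun j => Real.cos (α j)) (diagonal fun j => Real.sin (α j)) α := by
  have key : ∀ p q : ℂ, (p • toC (diagonal fun j => Real.cos (α j)) -
      q • toC (diagonal fun j => Real.sin (α j))) =
      diagonal fun j => p * (Real.cos (α j) : ℂ) - q * (Real.sin (α j) : ℂ) := by
    intro p q
    ext i j
    by_cases h : i = j
    · subst h; simp
    · simp [h]
  have k1 : detMinus (diagonal fun j => Real.cos (α j)) (diagonal fun j => Real.sin (α j)) =
      ∏ j, ((Real.cos (α j) : ℂ) - Complex.I * (Real.sin (α j) : ℂ)) := by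
    have := key 1 Complex.I
    simp only [one_smul, one_mul] at this
    rw [detMinus, this, det_diagonal]
  refine ⟨?_, fun z => ?_⟩
  · rw [k1]; exact Finset.prod_ne_zero_iff.2 fun j _ => cos_sub_I_mul_sin_ne_zero _
  · rw [k1, pencilDet, key, det_diagonal, ← Finset.prod_mul_distrib]
    refine Finset.prod_congr rfl fun j _ => ?_
    linear_combination expTwo_eq_div (α j)

/-- The Cayley transform sends an eigenvalue `tan α` to `(1 + i tan α) / (1 - i tan α) = e^{2iα}`.
-/
lemma EigenvaluesAreTan.hasPhases {M : Matrix (Fin n) (Fin n) ℝ} {α : Fin n → ℝ}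
    (h : EigenvaluesAreTan M α) : HasPhases 1 M α := by
  have hc : (toC M).charpoly = ∏ j, (X - C (Real.tan (α j) : ℂ)) := by
    have : (toC M).charpoly = M.charpoly.map Complex.ofRealHom := charpoly_map M _
    rw [this, h.2, Polynomial.map_prod]
    simp
  have hw : ∀ w : ℂ, (w • 1 - toC M).det = ∏ j, (w - Real.tan (α j)) := by
    intro w
    have h1 := congrArg (Polynomial.eval w) hc
    rw [Matrix.eval_charpoly, eval_prod] at h1
    simpa [← smul_one_eq_diagonal, Matrix.scalar_apply] using h1
  have key : ∀ p q : ℂ, (p • toC 1 - q • toC M).det = ∏ j, (p - q * Real.tan (α j)) := by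
    intro p q
    by_cases hq : q = 0
    · subst hq; simp
    · have : p • toC 1 - q • toC M = q • ((p / q) • 1 - toC M) := by
        rw [smul_sub, smul_smul, mul_div_cancel₀ _ hq, map_one]
      rw [this, det_smul, hw, Fintype.card_fin]
      have : q ^ n = ∏ j : Fin n, q := by simp
      rw [this, ← Finset.prod_mul_distrib]
      refine Finset.prod_congr rfl fun j _ => ?_
      field_simp
  have k1 : detMinus 1 M = ∏ j, (1 - Complex.I * Real.tan (α j)) := by
    have := key 1 Complex.I
    rwa [one_smul] at this
  have hcos : ∀ j, (Real.cos (α j) : ℂ) ≠ 0 := fun j => by exact_mod_cast h.1 j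
  have htan : ∀ j, (Real.tan (α j) : ℂ) = Real.sin (α j) / Real.cos (α j) := fun j => by
    rw [Real.tan_eq_sin_div_cos]; push_cast; rfl
  refine ⟨?_, fun z => ?_⟩
  · rw [k1]
    refine Finset.prod_ne_zero_iff.2 fun j _ => ?_
    have := cos_sub_I_mul_sin_ne_zero (α j)
    rw [htan]
    intro h0
    apply this
    have hj := hcos j
    field_simp at h0
    linear_combination h0
  · rw [k1, pencilDet, key, ← Finset.prod_mul_distrib]
    refine Finset.prod_congr rfl fun j _ => ?_
    have h2 := expTwo_eq_div (α j)
    have hj := hcos j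
    rw [htan]
    field_simp
    linear_combination h2

/-- Two systems of phases differ by a permutation and multiples of `π`, which change neither the
finiteness nor the values of the tangents. -/
lemma eigenvaluesAreTan_of_hasPhases {M : Matrix (Fin n) (Fin n) ℝ} {α β : Fin n → ℝ}
    (hβ : EigenvaluesAreTan M β) (hα : HasPhases 1 M α) : EigenvaluesAreTan M α := by
  obtain ⟨σ, hσ⟩ := hα.exists_perm hβ.hasPhases
  choose k hk using hσ
  refine ⟨fun j => ?_, ?_⟩
  · rw [hk, Real.cos_add_int_mul_pi]
    exact mul_ne_zero (zpow_ne_zero _ (by norm_num)) (hβ.1 _)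
  · rw [hβ.2, ← Equiv.prod_comp σ]
    refine Finset.prod_congr rfl fun j _ => ?_
    rw [hk, Real.tan_periodic.int_mul]

/-! ### Ordered angles: rigidity, compactness, continuity -/

/-- Since the spread is at most `π`, for `x ≥ α m` the summands are at least `1` when `j ≤ m` and at
least `0` otherwise; for `x < α m` they are at most `1` when `j < m` and at most `0` otherwise. The
order of the angles is thus recovered from a symmetric count, which depends only on their classes
modulo `π` and their sum. -/
lemma AnglesOrdered.le_iff {α : Fin n → ℝ} (h : AnglesOrdered α) (m : Fin n) (x : ℝ) :
    α m ≤ x ↔ ((m : ℤ) + 1) ≤ ∑ j, (⌊(x - α j) / Real.pi⌋ + 1) := by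
  have hpi := Real.pi_pos
  have hcard : ∑ j : Fin n, (if j ≤ m then (1 : ℤ) else 0) = m + 1 := by
    rw [Finset.sum_boole]
    have : Finset.univ.filter (fun j : Fin n => j ≤ m) = Finset.Iic m := by ext; simp
    rw [this, Fin.card_Iic]; push_cast; ring
  have hcard' : ∑ j : Fin n, (if j < m then (1 : ℤ) else 0) = m := by
    rw [Finset.sum_boole]
    have : Finset.univ.filter (fun j : Fin n => j < m) = Finset.Iio m := by ext; simp
    rw [this, Fin.card_Iio]
  constructor
  · intro hx
    rw [← hcard]
    refine Finset.sum_le_sum fun j _ => ?_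
    split_ifs with hj
    · have : (0 : ℤ) ≤ ⌊(x - α j) / Real.pi⌋ :=
        Int.floor_nonneg.2 (div_nonneg (by linarith [h.1 hj]) hpi.le)
      omega
    · have : (-1 : ℤ) ≤ ⌊(x - α j) / Real.pi⌋ := by
        rw [Int.le_floor, le_div_iff₀ hpi]
        have := h.2 j m
        push_cast; linarith
      omega
  · intro hx
    by_contra! hlt
    have : ∑ j, (⌊(x - α j) / Real.pi⌋ + 1) ≤ (m : ℤ) := by
      rw [← hcard']
      refine Finset.sum_le_sum fun j _ => ?_
      split_ifs with hj
      · have : ⌊(x - α j) / Real.pi⌋ < 1 := by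
          rw [Int.floor_lt, div_lt_iff₀ hpi]
          have := h.2 m j
          push_cast; linarith
        omega
      · have : ⌊(x - α j) / Real.pi⌋ < 0 := by
          rw [Int.floor_lt, div_lt_iff₀ hpi]
          have := h.1 (not_lt.1 hj)
          push_cast; linarith
        omega
    omega

/-- Ordered angles are determined by their classes modulo `π`, with multiplicity, and their sum. -/
lemma AnglesOrdered.eq_of_perm {α β : Fin n → ℝ} (hα : AnglesOrdered α) (hβ : AnglesOrdered β)
    (σ : Equiv.Perm (Fin n)) (hσ : ∀ j, ∃ k : ℤ, α j = β (σ j) + k * Real.pi)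
    (hsum : ∑ j, α j = ∑ j, β j) : α = β := by
  have hpi := Real.pi_pos
  choose k hk using hσ
  -- Equality of the sums makes the integer shifts cancel in total, so the floor counts of both
  -- families agree at every `x`.
  have hk0 : ∑ j, k j = 0 := by
    have h1 : ∑ j, α j = ∑ j, β j + (∑ j, k j : ℤ) * Real.pi := by
      rw [← Equiv.sum_comp σ β]
      simp only [hk, Finset.sum_add_distrib]
      push_cast; rw [Finset.sum_mul]
    have h2 : ((∑ j, k j : ℤ) : ℝ) * Real.pi = 0 := by linarith
    have h3 := (mul_eq_zero.1 h2).resolve_right hpi.ne'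
    exact_mod_cast h3
  have hcount : ∀ x : ℝ, ∑ j, (⌊(x - α j) / Real.pi⌋ + 1) = ∑ j, (⌊(x - β j) / Real.pi⌋ + 1) := by
    intro x
    rw [← Equiv.sum_comp σ fun j => ⌊(x - β j) / Real.pi⌋ + 1]
    have : ∀ j, ⌊(x - α j) / Real.pi⌋ + 1 = ⌊(x - β (σ j)) / Real.pi⌋ + 1 - k j := fun j => by
      have : (x - α j) / Real.pi = (x - β (σ j)) / Real.pi - (k j : ℝ) := by
        rw [hk]; field_simp; ring
      rw [this, Int.floor_sub_intCast]; ring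
    simp only [this, Finset.sum_sub_distrib, hk0, sub_zero]
  funext m
  apply le_antisymm
  · rw [hα.le_iff, hcount, ← hβ.le_iff]
  · rw [hβ.le_iff, ← hcount, ← hα.le_iff]

lemma HasPhases.eq_of_sum_eq {a b : Matrix (Fin n) (Fin n) ℝ} {α β : Fin n → ℝ}
    (hα : HasPhases a b α) (hβ : HasPhases a b β) (oα : AnglesOrdered α) (oβ : AnglesOrdered β)
    (hsum : ∑ j, α j = ∑ j, β j) : α = β := by
  obtain ⟨σ, hσ⟩ := hα.exists_perm hβ
  exact oα.eq_of_perm oβ σ hσ hsum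

lemma isClosed_anglesOrdered : IsClosed {α : Fin n → ℝ | AnglesOrdered α} := by
  have : {α : Fin n → ℝ | AnglesOrdered α} =
      {α | Monotone α} ∩ ⋂ j, ⋂ k, {α : Fin n → ℝ | α j ≤ α k + Real.pi} := by
    ext α; simp [AnglesOrdered]
  rw [this]
  exact isClosed_monotone.inter (isClosed_iInter fun j => isClosed_iInter fun k =>
    isClosed_le (continuous_apply j) ((continuous_apply k).add continuous_const))

/-- Every angle lies within `π` of every other, hence near their average; a bound on the sum then
confines the whole family to a compact box. -/
lemma abs_le_of_width {α : Fin n → ℝ} (h : AnglesOrdered α) (j : Fin n) :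
    |α j| ≤ |∑ k, α k| + n * Real.pi := by
  have hn : (1 : ℝ) ≤ n := by exact_mod_cast (Fin.pos j)
  have hpi := Real.pi_pos
  have h1 : |∑ k, (α j - α k)| ≤ n * Real.pi := by
    refine (Finset.abs_sum_le_sum_abs _ _).trans ?_
    refine (Finset.sum_le_sum (g := fun _ => Real.pi) fun k _ => ?_).trans (by simp)
    rw [abs_le]; constructor <;> linarith [h.2 j k, h.2 k j]
  have h2 : ∑ k, (α j - α k) = n * α j - ∑ k, α k := by simp [Finset.sum_sub_distrib]
  rw [h2] at h1
  have h3 : |n * α j| ≤ |∑ k, α k| + n * Real.pi := by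
    calc |n * α j| = |(∑ k, α k) + (n * α j - ∑ k, α k)| := by congr 1; ring
      _ ≤ _ := (abs_add_le _ _).trans (by linarith)
  rw [abs_mul, Nat.abs_cast] at h3
  nlinarith [abs_nonneg (α j)]

lemma isCompact_anglesOrdered (c : ℝ) :
    IsCompact {α : Fin n → ℝ | AnglesOrdered α ∧ |∑ j, α j| ≤ c} := by
  refine (isCompact_univ_pi (s := fun _ : Fin n => Icc (-(c + n * Real.pi)) (c + n * Real.pi))
    fun _ => isCompact_Icc).of_isClosed_subset ?_ ?_
  · have hs : Continuous fun α : Fin n → ℝ => |∑ j, α j| := by fun_prop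
    exact isClosed_anglesOrdered.inter (isClosed_le hs continuous_const)
  · rintro α ⟨h, hc⟩ j -
    exact abs_le.1 ((abs_le_of_width h j).trans (by linarith))

lemma eq_of_tendsto_of_mapClusterPt {T Z : Type*} [TopologicalSpace Z] [T2Space Z]
    {l : Filter T} {f : T → Z} {x y : Z} (h : Filter.Tendsto f l (nhds x))
    (hy : MapClusterPt y l f) : y = x :=
  eq_of_nhds_neBot (ClusterPt.mono hy h)

open Filter Topology in
/-- Ordered angles with a continuous sum depend continuously on the matrices. -/
lemma continuous_of_hasPhases {T : Type*} [TopologicalSpace T]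
    {a b : T → Matrix (Fin n) (Fin n) ℝ} (ha : Continuous a) (hb : Continuous b)
    {α : T → Fin n → ℝ} (hα : ∀ t, HasPhases (a t) (b t) (α t)) (ho : ∀ t, AnglesOrdered (α t))
    (hsum : Continuous fun t => ∑ j, α t j) : Continuous α := by
  have ha' : Continuous fun t => toC (a t) := ha.matrix_map Complex.continuous_ofReal
  have hb' : Continuous fun t => toC (b t) := hb.matrix_map Complex.continuous_ofReal
  have hdet : Continuous fun t => detMinus (a t) (b t) := by
    unfold detMinus
    exact Continuous.matrix_det (by fun_prop)
  have hpen : ∀ z, Continuous fun t => pencilDet (a t) (b t) z := fun z => by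
    unfold pencilDet
    exact Continuous.matrix_det (by fun_prop)
  rw [continuous_iff_continuousAt]
  intro t₀
  -- Near `t₀` the angles stay in a compact set. Any cluster point is ordered, has the right sum and
  -- is again a system of phases of the pair at `t₀`, so rigidity identifies it with `α t₀`.
  refine (isCompact_anglesOrdered (n := n) (|∑ j, α t₀ j| + 1)).tendsto_nhds_of_unique_mapClusterPt
    ?_ ?_
  · have : ∀ᶠ t in 𝓝 t₀, |∑ j, α t j| < |∑ j, α t₀ j| + 1 :=
      hsum.abs.continuousAt.eventually_lt_const (by linarith)
    filter_upwards [this] with t ht using ⟨ho t, ht.le⟩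
  · intro β hβ hcl
    have hs : ∑ j, β j = ∑ j, α t₀ j := by
      have h1 : MapClusterPt (∑ j, β j) (𝓝 t₀) fun t => ∑ j, α t j :=
        hcl.tendsto_comp (f := fun γ : Fin n → ℝ => ∑ j, γ j)
          (Continuous.tendsto (by fun_prop) β)
      exact eq_of_tendsto_of_mapClusterPt hsum.continuousAt h1
    refine HasPhases.eq_of_sum_eq (a := a t₀) (b := b t₀) ⟨(hα t₀).1, fun z => ?_⟩ (hα t₀)
      hβ.1 (ho t₀) hs
    have h1 : MapClusterPt (∏ j, (z - expTwo (β j))) (𝓝 t₀)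
        fun t => ∏ j, (z - expTwo (α t j)) :=
      hcl.tendsto_comp (f := fun γ : Fin n → ℝ => ∏ j, (z - expTwo (γ j)))
        (Continuous.tendsto (by fun_prop) β)
    have h2 : Tendsto (fun t => ∏ j, (z - expTwo (α t j))) (𝓝 t₀)
        (𝓝 (pencilDet (a t₀) (b t₀) z / detMinus (a t₀) (b t₀))) := by
      have : (fun t => ∏ j, (z - expTwo (α t j))) =
          fun t => pencilDet (a t) (b t) z / detMinus (a t) (b t) := by
        funext t; rw [(hα t).2 z, mul_div_cancel_left₀ _ (hα t).1]
      rw [this]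
      exact ((hpen z).tendsto t₀).div (hdet.tendsto t₀) (hα t₀).1
    rw [eq_of_tendsto_of_mapClusterPt h2 h1, mul_div_cancel₀ _ (hα t₀).1]

/-! ### Adjusting the phase sum by multiples of `π` -/

/-- Raising a smallest angle by `π` keeps the spread at most `π`. -/
lemma HasPhases.exists_sum_add {a b : Matrix (Fin n) (Fin n) ℝ} [NeZero n] {α : Fin n → ℝ}
    (hα : HasPhases a b α) (hw : ∀ j k, α j ≤ α k + Real.pi) :
    ∃ β, HasPhases a b β ∧ (∀ j k, β j ≤ β k + Real.pi) ∧ ∑ j, β j = ∑ j, α j + Real.pi := by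
  have hpi := Real.pi_pos
  obtain ⟨m, hm⟩ := Finite.exists_min α
  refine ⟨Function.update α m (α m + Real.pi), hα.of_congr fun j => ?_, fun j k => ?_, ?_⟩
  · by_cases hj : j = m
    · subst hj; simp [expTwo_add_pi]
    · simp [hj]
  · by_cases hj : j = m <;> by_cases hk : k = m
    · subst hj; subst hk; linarith
    · subst hj; simp [hk]; linarith [hm k]
    · subst hk; simp [hj]; linarith [hw j k]
    · simp [hj, hk]; exact hw j k
  · rw [Finset.sum_update_of_mem (Finset.mem_univ m),
      ← Finset.add_sum_erase _ α (Finset.mem_univ m), Finset.sdiff_singleton_eq_erase]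
    ring

/-- Here a largest angle is lowered by `π`. -/
lemma HasPhases.exists_sum_sub {a b : Matrix (Fin n) (Fin n) ℝ} [NeZero n] {α : Fin n → ℝ}
    (hα : HasPhases a b α) (hw : ∀ j k, α j ≤ α k + Real.pi) :
    ∃ β, HasPhases a b β ∧ (∀ j k, β j ≤ β k + Real.pi) ∧ ∑ j, β j = ∑ j, α j - Real.pi := by
  have hpi := Real.pi_pos
  obtain ⟨m, hm⟩ := Finite.exists_max α
  refine ⟨Function.update α m (α m - Real.pi), hα.of_congr fun j => ?_, fun j k => ?_, ?_⟩
  · by_cases hj : j = m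
    · subst hj; simp [expTwo_sub_pi]
    · simp [hj]
  · by_cases hj : j = m <;> by_cases hk : k = m
    · subst hj; subst hk; linarith
    · subst hj; simp [hk]; linarith [hw j k]
    · subst hk; simp [hj]; linarith [hm j]
    · simp [hj, hk]; exact hw j k
  · rw [Finset.sum_update_of_mem (Finset.mem_univ m),
      ← Finset.add_sum_erase _ α (Finset.mem_univ m), Finset.sdiff_singleton_eq_erase]
    ring

/-- Phases can be ordered so as to have any sum compatible with the determinants. -/
lemma HasPhases.exists_ordered {a b : Matrix (Fin n) (Fin n) ℝ} [NeZero n] {α : Fin n → ℝ}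
    (hα : HasPhases a b α) {s : ℝ} (hs : detPlus a b = detMinus a b * expTwo s) :
    ∃ β, HasPhases a b β ∧ AnglesOrdered β ∧ ∑ j, β j = s := by
  have hpi := Real.pi_pos
  have hstart : ∃ β, HasPhases a b β ∧ ∀ j k, β j ≤ β k + Real.pi := by
    -- Representatives in `[0, π)` have spread less than `π`.
    refine ⟨fun j => toIcoMod Real.pi_pos 0 (α j), hα.of_congr fun j => ?_, fun j k => ?_⟩
    · refine expTwo_eq_iff.2 ⟨toIcoDiv Real.pi_pos 0 (α j), ?_⟩
      simp
    · have h1 := toIcoMod_mem_Ico Real.pi_pos 0 (α j)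
      have h2 := toIcoMod_mem_Ico Real.pi_pos 0 (α k)
      linarith [h1.2, h2.1]
  obtain ⟨β, hβ, hw⟩ := hstart
  have hshift : ∀ k : ℤ, ∃ γ, HasPhases a b γ ∧ (∀ j k, γ j ≤ γ k + Real.pi) ∧
      ∑ j, γ j = ∑ j, β j + k * Real.pi := by
    intro k
    induction k with
    | zero => exact ⟨β, hβ, hw, by simp⟩
    | succ k ih =>
      obtain ⟨γ, h1, h2, h3⟩ := ih
      obtain ⟨δ, h4, h5, h6⟩ := h1.exists_sum_add h2
      exact ⟨δ, h4, h5, by rw [h6, h3]; push_cast; ring⟩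
    | pred k ih =>
      obtain ⟨γ, h1, h2, h3⟩ := ih
      obtain ⟨δ, h4, h5, h6⟩ := h1.exists_sum_sub h2
      exact ⟨δ, h4, h5, by rw [h6, h3]; push_cast; ring⟩
  rw [hβ.detPlus_eq] at hs
  obtain ⟨k, hk⟩ := expTwo_eq_iff.1 (mul_left_cancel₀ hβ.1 hs.symm)
  obtain ⟨γ, h1, h2, h3⟩ := hshift k
  refine ⟨γ ∘ Tuple.sort γ, h1.comp_perm _, ⟨Tuple.monotone_sort γ, fun j k => h2 _ _⟩, ?_⟩
  rw [hk, ← h3]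
  exact Equiv.sum_comp (Tuple.sort γ) γ

/-! ### Counting multiples of `π` -/

/-- The integer by which an angle differs from its matched representative in `[0, π)` is exactly `⌊α
j / π⌋`. -/
lemma HasPhases.sum_sub_sum {a b : Matrix (Fin n) (Fin n) ℝ} {α ρ : Fin n → ℝ}
    (hα : HasPhases a b α) (hρ : HasPhases a b ρ) (h : ∀ j, ρ j ∈ Ico 0 Real.pi) :
    ∑ j, α j - ∑ j, ρ j = Real.pi * ((∑ j, ⌊α j / Real.pi⌋ : ℤ) : ℝ) := by
  have hpi := Real.pi_pos
  obtain ⟨σ, hσ⟩ := hα.exists_perm hρ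
  choose k hk using hσ
  have hfl : ∀ j, ⌊α j / Real.pi⌋ = k j := fun j => by
    rw [hk, Int.floor_eq_iff, le_div_iff₀ hpi, div_lt_iff₀ hpi]
    constructor <;> nlinarith [(h (σ j)).1, (h (σ j)).2]
  rw [← Equiv.sum_comp σ ρ, ← Finset.sum_sub_distrib]
  simp only [hfl]
  push_cast
  rw [Finset.mul_sum]
  refine Finset.sum_congr rfl fun j _ => ?_
  rw [hk]; ring

lemma sin_eq_zero_iff_of_expTwo {s : ℝ} : Real.sin s = 0 ↔ expTwo s = 1 := by
  rw [Real.sin_eq_zero_iff, ← expTwo_int_mul_pi 0, expTwo_eq_iff]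
  simp [eq_comm]

lemma HasPhases.card_sin_ne_zero {a b : Matrix (Fin n) (Fin n) ℝ} {α β : Fin n → ℝ}
    (hα : HasPhases a b α) (hβ : HasPhases a b β) :
    Fintype.card {j // Real.sin (α j) ≠ 0} = Fintype.card {j // Real.sin (β j) ≠ 0} := by
  obtain ⟨σ, hσ⟩ := hα.exists_perm hβ
  refine Fintype.card_congr (σ.subtypeEquiv fun j => ?_)
  rw [not_iff_not, sin_eq_zero_iff_of_expTwo, sin_eq_zero_iff_of_expTwo, expTwo_eq_iff.2 (hσ j)]

open Filter Topology in
/-- Along a path of angles on which the number of multiples of `π` is constant, no multiple of `π`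
is crossed. -/
lemma isLocallyConstant_sum_floor {T : Type*} [TopologicalSpace T] {α : T → Fin n → ℝ}
    (hα : Continuous α) {r : ℕ} (hr : ∀ t, Fintype.card {j // Real.sin (α t j) ≠ 0} = r) :
    IsLocallyConstant fun t => ∑ j, ⌊α t j / Real.pi⌋ := by
  have hpi := Real.pi_pos
  have hcj : ∀ j, Continuous fun t => α t j := fun j => (continuous_apply j).comp hα
  rw [IsLocallyConstant.iff_eventually_eq]
  intro t₀
  have h1 : ∀ j, ∀ᶠ t in 𝓝 t₀, Real.sin (α t₀ j) ≠ 0 → Real.sin (α t j) ≠ 0 := fun j => by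
    by_cases h : Real.sin (α t₀ j) = 0
    · simp [h]
    · have := (Real.continuous_sin.comp (hcj j)).continuousAt.eventually_ne h
      filter_upwards [this] with t ht _ using ht
  have h2 : ∀ j, ∀ᶠ t in 𝓝 t₀, Real.sin (α t₀ j) ≠ 0 →
      ⌊α t j / Real.pi⌋ = ⌊α t₀ j / Real.pi⌋ := fun j => by
    by_cases h : Real.sin (α t₀ j) = 0
    · simp [h]
    · have hc : ContinuousAt (fun t => α t j / Real.pi) t₀ := ((hcj j).div_const _).continuousAt
      have hlt : (⌊α t₀ j / Real.pi⌋ : ℝ) < α t₀ j / Real.pi := by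
        refine lt_of_le_of_ne (Int.floor_le _) fun he => h ?_
        rw [eq_div_iff hpi.ne'] at he
        rw [← he]; exact Real.sin_int_mul_pi _
      filter_upwards [hc.eventually_const_lt hlt,
        hc.eventually_lt_const (Int.lt_floor_add_one _)] with t h3 h4 _
      exact Int.floor_eq_iff.2 ⟨h3.le, h4⟩
  have h3 : ∀ j, ∀ᶠ t in 𝓝 t₀, |α t j / Real.pi - α t₀ j / Real.pi| < 1 := fun j => by
    have hc : Continuous (fun t => |α t j / Real.pi - α t₀ j / Real.pi|) :=
      (((hcj j).div_const _).sub continuous_const).abs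
    exact hc.continuousAt.eventually_lt_const (by simp)
  filter_upwards [eventually_all.2 h1, eventually_all.2 h2, eventually_all.2 h3] with t k1 k2 k3
  -- Nonvanishing of a sine persists nearby; as the number of nonzero sines is constant, vanishing
  -- persists as well.
  have hiff : ∀ j, Real.sin (α t j) ≠ 0 → Real.sin (α t₀ j) ≠ 0 := by
    have hsub : Finset.univ.filter (fun j => Real.sin (α t₀ j) ≠ 0) ⊆
        Finset.univ.filter fun j => Real.sin (α t j) ≠ 0 :=
      fun j hj => by simpa using k1 j (by simpa using hj)
    have := Finset.eq_of_subset_of_card_le hsub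
      (by rw [← Fintype.card_subtype, ← Fintype.card_subtype, hr, hr])
    intro j hj
    have hj' : j ∈ Finset.univ.filter fun j => Real.sin (α t j) ≠ 0 := by simpa using hj
    rw [← this] at hj'
    simpa using hj'
  refine Finset.sum_congr rfl fun j _ => ?_
  -- An angle that remains a multiple of `π` while moving by less than `π` remains the same
  -- multiple.
  by_cases h : Real.sin (α t₀ j) = 0
  · have ht : Real.sin (α t j) = 0 := by by_contra h'; exact hiff j h' h
    obtain ⟨k, hk⟩ := Real.sin_eq_zero_iff.1 h
    obtain ⟨l, hl⟩ := Real.sin_eq_zero_iff.1 ht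
    have := k3 j
    rw [← hk, ← hl, mul_div_cancel_right₀ _ hpi.ne', mul_div_cancel_right₀ _ hpi.ne'] at this ⊢
    have hkl : |l - k| < 1 := by exact_mod_cast this
    rw [Int.abs_lt_one_iff] at hkl
    rw [sub_eq_zero.1 hkl]
  · exact k2 j h

/-! ### Lagrangian pairs and the existence of phases -/

lemma exists_eigenvaluesAreTan {M : Matrix (Fin n) (Fin n) ℝ} (hM : M.IsSymm) :
    ∃ τ : Fin n → ℝ, (∀ j, τ j ∈ Ico 0 Real.pi) ∧ EigenvaluesAreTan M τ := by
  have hH : M.IsHermitian := by rw [IsHermitian, conjTranspose_eq_transpose_of_trivial]; exact hM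
  have key : ∀ μ : ℝ, ∃ t ∈ Ico 0 Real.pi, Real.cos t ≠ 0 ∧ Real.tan t = μ := by
    intro μ
    have h1 := Real.neg_pi_div_two_lt_arctan μ
    have h2 := Real.arctan_lt_pi_div_two μ
    have h3 := Real.pi_pos
    by_cases h : 0 ≤ μ
    · exact ⟨Real.arctan μ, ⟨Real.arctan_nonneg.2 h, by linarith⟩,
        (Real.cos_arctan_pos μ).ne', Real.tan_arctan μ⟩
    · have h4 : Real.arctan μ < 0 := Real.arctan_lt_zero.2 (not_le.1 h)
      refine ⟨Real.arctan μ + Real.pi, ⟨by linarith, by linarith⟩, ?_, ?_⟩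
      · rw [Real.cos_add_pi]; exact neg_ne_zero.2 (Real.cos_arctan_pos μ).ne'
      · rw [Real.tan_add_pi, Real.tan_arctan]
  choose t ht hc htan using key
  refine ⟨fun j => t (hH.eigenvalues j), fun j => ht _, fun j => hc _, ?_⟩
  rw [hH.charpoly_eq]
  simp [htan]

lemma toC_conj_mul {a b : Matrix (Fin n) (Fin n) ℝ} (hs : aᵀ * b = bᵀ * a) :
    (toC aᵀ - Complex.I • toC bᵀ) * (toC a + Complex.I • toC b) = toC (aᵀ * a + bᵀ * b) := by
  have h : toC aᵀ * toC b = toC bᵀ * toC a := by rw [← map_mul, hs, map_mul]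
  simp only [map_add, map_mul, sub_mul, mul_add, Matrix.smul_mul, Matrix.mul_smul, smul_smul,
    Complex.I_mul_I, h]
  module

/-- By the Lagrangian relation `(aᵀ - i bᵀ)(a + i b) = aᵀ a + bᵀ b`. The right side is injective,
because a vector it kills is killed by both `a` and `b`, hence by `c a + d b = 1`. -/
lemma detPlus_ne_zero {a b c d : Matrix (Fin n) (Fin n) ℝ} (hs : aᵀ * b = bᵀ * a)
    (hinv : c * a + d * b = 1) : detPlus a b ≠ 0 := by
  have hu : IsUnit (aᵀ * a + bᵀ * b) := by
    rw [← Matrix.mulVec_injective_iff_isUnit]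
    refine (injective_iff_map_eq_zero (Matrix.mulVecLin (aᵀ * a + bᵀ * b))).2 fun x hx => ?_
    have h1 : (a *ᵥ x) ⬝ᵥ (a *ᵥ x) + (b *ᵥ x) ⬝ᵥ (b *ᵥ x) = 0 := by
      have h2 := congrArg (fun y => x ⬝ᵥ y) hx
      simp only [mulVecLin_apply, add_mulVec, dotProduct_add, ← mulVec_mulVec,
        dotProduct_zero] at h2
      rwa [dotProduct_mulVec, vecMul_transpose, dotProduct_mulVec x bᵀ, vecMul_transpose] at h2
    have ha : 0 ≤ (a *ᵥ x) ⬝ᵥ (a *ᵥ x) := Finset.sum_nonneg fun i _ => mul_self_nonneg _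
    have hb : 0 ≤ (b *ᵥ x) ⬝ᵥ (b *ᵥ x) := Finset.sum_nonneg fun i _ => mul_self_nonneg _
    have ha0 : a *ᵥ x = 0 := dotProduct_self_eq_zero.1 (by linarith)
    have hb0 : b *ᵥ x = 0 := dotProduct_self_eq_zero.1 (by linarith)
    rw [← one_mulVec x, ← hinv, add_mulVec, ← mulVec_mulVec, ← mulVec_mulVec, ha0, hb0]
    simp
  have := ((Matrix.isUnit_iff_isUnit_det _).1 (hu.map toC)).ne_zero
  rw [← toC_conj_mul hs, det_mul] at this
  exact right_ne_zero_of_mul this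

/-- The real polynomial `det (a + X b)` does not vanish at `i`, so it is not zero and some real
number is not a root. -/
lemma exists_isUnit_add_smul {a b : Matrix (Fin n) (Fin n) ℝ} (h : detPlus a b ≠ 0) :
    ∃ z : ℝ, IsUnit (a + z • b) := by
  let p : ℝ[X] := (a.map C + (X : ℝ[X]) • b.map C).det
  have hp : p ≠ 0 := by
    intro h0
    apply h
    have h1 : p.eval₂ Complex.ofRealHom Complex.I = 0 := by rw [h0]; simp
    have h2 : p.eval₂ Complex.ofRealHom Complex.I = detPlus a b := by
      change (Polynomial.eval₂RingHom Complex.ofRealHom Complex.I) p = _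
      rw [RingHom.map_det, detPlus]
      congr 1
      ext i j
      simp
      exact mul_comm _ _
    rw [← h2, h1]
  obtain ⟨z, hz⟩ : ∃ z, p.eval z ≠ 0 := by
    by_contra! hc
    exact hp (Polynomial.funext fun z => by simpa using hc z)
  refine ⟨z, (Matrix.isUnit_iff_isUnit_det _).2 ?_⟩
  have h2 : p.eval z = (a + z • b).det := by
    change (Polynomial.evalRingHom z) p = _
    rw [RingHom.map_det]
    congr 1
    ext i j
    simp
    exact mul_comm _ _
  rw [← h2]
  exact isUnit_iff_ne_zero.2 hz

lemma isSymm_mul_inv {a b : Matrix (Fin n) (Fin n) ℝ} (hs : aᵀ * b = bᵀ * a) (ha : IsUnit a) :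
    (b * a⁻¹).IsSymm := by
  have hd := (Matrix.isUnit_iff_isUnit_det _).1 ha
  have hd' : IsUnit aᵀ.det := by rwa [det_transpose]
  rw [IsSymm, transpose_mul, transpose_nonsing_inv]
  calc aᵀ⁻¹ * bᵀ = aᵀ⁻¹ * (bᵀ * a) * a⁻¹ := by
        rw [mul_assoc, mul_assoc, Matrix.mul_nonsing_inv _ hd, mul_one]
    _ = b * a⁻¹ := by rw [← hs, ← mul_assoc, Matrix.nonsing_inv_mul _ hd', one_mul]

/-- Phases of a Lagrangian pair exist; as many are multiples of `π` as `b` has corank. -/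
lemma exists_hasPhases {a b : Matrix (Fin n) (Fin n) ℝ} (hs : aᵀ * b = bᵀ * a)
    (h : detPlus a b ≠ 0) :
    ∃ α, HasPhases a b α ∧ Fintype.card {j // Real.sin (α j) ≠ 0} = b.rank := by
  obtain ⟨z, hz⟩ := exists_isUnit_add_smul h
  -- Rotating the pair by `β` makes its first member `cos β • (a + z • b)`, which is invertible. The
  -- rotated quotient is symmetric and can be diagonalized; undoing the rotation adds `β` to each
  -- angle.
  set β := Real.arctan z with hβ
  have hcβ : Real.cos β ≠ 0 := (Real.cos_arctan_pos z).ne'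
  have hsβ : Real.sin β = z * Real.cos β := by
    have := Real.tan_arctan z
    rw [← hβ, Real.tan_eq_sin_div_cos, div_eq_iff hcβ] at this
    exact this
  set a' := Real.cos β • a + Real.sin β • b with ha'
  set b' := Real.cos β • b - Real.sin β • a with hb'
  have hua : IsUnit a' := by
    have : a' = (Units.mk0 _ hcβ) • (a + z • b) := by
      rw [ha', hsβ, Units.smul_def, Units.val_mk0]; module
    rw [this]; exact hz.smul _
  have hs' : a'ᵀ * b' = b'ᵀ * a' := by
    simp only [ha', hb', transpose_add, transpose_sub, transpose_smul, add_mul, sub_mul, mul_sub,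
      mul_add, Matrix.smul_mul, Matrix.mul_smul, hs]
    module
  have hM := isSymm_mul_inv hs' hua
  set M := b' * a'⁻¹ with hMdef
  have hH : M.IsHermitian := by rw [IsHermitian, conjTranspose_eq_transpose_of_trivial]; exact hM
  have hMa : M * a' = b' := by
    rw [hMdef, mul_assoc, Matrix.nonsing_inv_mul _ ((Matrix.isUnit_iff_isUnit_det _).1 hua),
      mul_one]
  set O : Matrix (Fin n) (Fin n) ℝ := (hH.eigenvectorUnitary : Matrix (Fin n) (Fin n) ℝ)
  have hO : O * star O = 1 := Unitary.coe_mul_star_self _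
  have hO' : star O * O = 1 := Unitary.coe_star_mul_self _
  have huO : IsUnit O := ⟨⟨O, star O, hO, hO'⟩, rfl⟩
  have huO' : IsUnit (star O) := ⟨⟨star O, O, hO', hO⟩, rfl⟩
  have hspec : M = O * diagonal hH.eigenvalues * star O := by
    have := hH.spectral_theorem
    rw [Unitary.conjStarAlgAut_apply] at this
    exact this
  set γ := fun j => Real.arctan (hH.eigenvalues j) with hγ
  have hcγ : ∀ j, Real.cos (γ j) ≠ 0 := fun j => (Real.cos_arctan_pos _).ne'
  have htan : ∀ j, hH.eigenvalues j * Real.cos (γ j) = Real.sin (γ j) := fun j => by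
    have := Real.tan_arctan (hH.eigenvalues j)
    rw [Real.tan_eq_sin_div_cos, div_eq_iff (Real.cos_arctan_pos _).ne'] at this
    exact this.symm
  set Z := diagonal (fun j => (Real.cos (γ j))⁻¹) * star O * a' with hZ
  have huZ : IsUnit Z := by
    refine ((Matrix.isUnit_iff_isUnit_det _).2 ?_ |>.mul huO').mul hua
    rw [det_diagonal]
    exact isUnit_iff_ne_zero.2 (Finset.prod_ne_zero_iff.2 fun j _ => inv_ne_zero (hcγ j))
  have hfac : ∀ f : Fin n → ℝ, O * diagonal f * Z =
      O * diagonal (fun j => f j * (Real.cos (γ j))⁻¹) * star O * a' := fun f => by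
    rw [hZ, ← diagonal_mul_diagonal]; simp only [mul_assoc]
  have hab : ∀ p q : ℝ, O * diagonal (fun j => p + q * hH.eigenvalues j) * star O * a' =
      p • a' + q • b' := fun p q => by
    have : diagonal (fun j => p + q * hH.eigenvalues j) =
        p • (1 : Matrix (Fin n) (Fin n) ℝ) + q • diagonal hH.eigenvalues := by
      ext i j; by_cases hij : i = j
      · subst hij; simp
      · simp [hij]
    rw [this, mul_add O, add_mul _ _ (star O), add_mul _ _ a', Matrix.mul_smul, Matrix.mul_smul,
      Matrix.smul_mul, Matrix.smul_mul, Matrix.smul_mul, Matrix.smul_mul, mul_one, hO, one_mul,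
      ← hspec, hMa]
  have hA : O * diagonal (fun j => Real.cos (γ j + β)) * Z = a := by
    rw [hfac]
    have : (fun j => Real.cos (γ j + β) * (Real.cos (γ j))⁻¹) =
        fun j => Real.cos β + (-Real.sin β) * hH.eigenvalues j := by
      funext j
      have := hcγ j
      rw [Real.cos_add, ← htan]; field_simp; ring
    rw [this, hab, ha', hb']
    have h1 := Real.sin_sq_add_cos_sq β
    have : Real.cos β • (Real.cos β • a + Real.sin β • b) +
        -Real.sin β • (Real.cos β • b - Real.sin β • a) =
        (Real.sin β ^ 2 + Real.cos β ^ 2) • a := by module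
    rw [this, h1, one_smul]
  have hB : O * diagonal (fun j => Real.sin (γ j + β)) * Z = b := by
    rw [hfac]
    have : (fun j => Real.sin (γ j + β) * (Real.cos (γ j))⁻¹) =
        fun j => Real.sin β + Real.cos β * hH.eigenvalues j := by
      funext j
      have := hcγ j
      rw [Real.sin_add, ← htan]; field_simp; ring
    rw [this, hab, ha', hb']
    have h1 := Real.sin_sq_add_cos_sq β
    have : Real.sin β • (Real.cos β • a + Real.sin β • b) +
        Real.cos β • (Real.cos β • b - Real.sin β • a) =
        (Real.sin β ^ 2 + Real.cos β ^ 2) • b := by module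
    rw [this, h1, one_smul]
  refine ⟨fun j => γ j + β, ?_, ?_⟩
  · have := (hasPhases_diagonal fun j => γ j + β).mul_mul huO huZ
    rwa [hA, hB] at this
  · rw [← Matrix.rank_diagonal fun j => Real.sin (γ j + β), ← hB,
      Matrix.rank_mul_eq_left_of_isUnit_det _ _ ((Matrix.isUnit_iff_isUnit_det _).1 huZ),
      Matrix.rank_mul_eq_right_of_isUnit_det _ _ ((Matrix.isUnit_iff_isUnit_det _).1 huO)]

/-! ### Continuous phases over a simply connected space -/

lemma detMinus_eq_conj (a b : Matrix (Fin n) (Fin n) ℝ) :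
    detMinus a b = starRingEnd ℂ (detPlus a b) := by
  rw [detMinus, detPlus, RingHom.map_det]
  congr 1
  ext i j
  simp [sub_eq_add_neg]

/-- A continuous argument of `det (a + i b)`, over a simply connected space. -/
lemma exists_continuous_arg {T : Type*} [TopologicalSpace T] [SimplyConnectedSpace T]
    [LocallyPathConnectedSpace T] {a b : T → Matrix (Fin n) (Fin n) ℝ} (ha : Continuous a)
    (hb : Continuous b) (h : ∀ t, detPlus (a t) (b t) ≠ 0) :
    ∃ s : T → ℝ, Continuous s ∧
      ∀ t, detPlus (a t) (b t) = detMinus (a t) (b t) * expTwo (s t) := by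
  have ha' : Continuous fun t => toC (a t) := ha.matrix_map Complex.continuous_ofReal
  have hb' : Continuous fun t => toC (b t) := hb.matrix_map Complex.continuous_ofReal
  have hdet : Continuous fun t => detPlus (a t) (b t) := by
    unfold detPlus
    exact Continuous.matrix_det (by fun_prop)
  obtain ⟨t₀⟩ : Nonempty T := inferInstance
  -- `F` is a continuous logarithm of `det (a + i b)`. The determinant of `a - i b` is the
  -- conjugate, so the quotient is `e^{2i Im F}`.
  obtain ⟨F, ⟨-, hF⟩, -⟩ := Complex.isCoveringMapOn_exp.existsUnique_continuousMap_lifts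
    ⟨_, hdet⟩ (Complex.exp_log (h t₀)) h
  have hF' : ∀ t, Complex.exp (F t) = detPlus (a t) (b t) := fun t => congrFun hF t
  refine ⟨fun t => (F t).im, by fun_prop, fun t => ?_⟩
  rw [detMinus_eq_conj, ← hF', ← Complex.exp_conj, expTwo, ← Complex.exp_add]
  congr 1
  apply Complex.ext <;> simp
  ring

/-- A continuous family of Lagrangian pairs has continuous ordered phases, with any given sum at a
given point, compatible with the determinants. -/
lemma exists_continuous_phases {T : Type*} [TopologicalSpace T] [SimplyConnectedSpace T]
    [LocallyPathConnectedSpace T] [NeZero n] {a b : T → Matrix (Fin n) (Fin n) ℝ}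
    (ha : Continuous a) (hb : Continuous b) (hs : ∀ t, (a t)ᵀ * b t = (b t)ᵀ * a t)
    (h : ∀ t, detPlus (a t) (b t) ≠ 0) (t₀ : T) {r : ℝ}
    (hr : detPlus (a t₀) (b t₀) = detMinus (a t₀) (b t₀) * expTwo r) :
    ∃ α : T → Fin n → ℝ, Continuous α ∧ (∀ t, HasPhases (a t) (b t) (α t)) ∧
      (∀ t, AnglesOrdered (α t)) ∧ ∑ j, α t₀ j = r := by
  obtain ⟨s, hs1, hs2⟩ := exists_continuous_arg ha hb h
  have hm : ∀ t, detMinus (a t) (b t) ≠ 0 := fun t => by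
    rw [detMinus_eq_conj]; simpa using h t
  have h0 : expTwo (s t₀) = expTwo r := mul_left_cancel₀ (hm t₀) ((hs2 t₀).symm.trans hr)
  obtain ⟨k, hk⟩ := expTwo_eq_iff.1 h0
  have key : ∀ t, ∃ α, HasPhases (a t) (b t) α ∧ AnglesOrdered α ∧
      ∑ j, α j = s t - k * Real.pi := fun t => by
    obtain ⟨α, hα, -⟩ := exists_hasPhases (hs t) (h t)
    refine hα.exists_ordered ?_
    rw [hs2 t]
    congr 1
    exact expTwo_eq_iff.2 ⟨k, by ring⟩
  choose α h1 h2 h3 using key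
  refine ⟨α, continuous_of_hasPhases ha hb h1 h2 ?_, h1, h2, by rw [h3, hk]; ring⟩
  simp only [h3]
  fun_prop

/-! ### The scalar equation `u'' = q u` -/

/-- The solution of `u'' = q u` with `u 0 = 1`, `u' 0 = 0`. -/
def cSol (q δ : ℝ) : ℝ := xiFun (q * δ ^ 2)

/-- The solution of `u'' = q u` with `u 0 = 0`, `u' 0 = 1`. -/
def sSol (q δ : ℝ) : ℝ := δ * etaZero (q * δ ^ 2)

lemma sqrt_mul_sq {q : ℝ} (hq : 0 ≤ q) (δ : ℝ) : √(q * δ ^ 2) = √q * |δ| := by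
  rw [Real.sqrt_mul hq, Real.sqrt_sq_eq_abs]

lemma cSol_of_pos {q : ℝ} (hq : 0 < q) : cSol q = fun δ => Real.cosh (√q * δ) := by
  funext δ
  rcases eq_or_ne δ 0 with rfl | hδ
  · simp [cSol, xiFun]
  · have : 0 < q * δ ^ 2 := by positivity
    rw [cSol, xiFun, if_neg (not_le.2 this), sqrt_mul_sq hq.le, ← Real.cosh_abs (√q * δ), abs_mul,
      abs_of_nonneg (Real.sqrt_nonneg q)]

lemma sSol_of_pos {q : ℝ} (hq : 0 < q) : sSol q = fun δ => Real.sinh (√q * δ) / √q := by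
  funext δ
  rcases eq_or_ne δ 0 with rfl | hδ
  · simp [sSol]
  · have : 0 < q * δ ^ 2 := by positivity
    have hr : 0 < √q := Real.sqrt_pos.2 hq
    rw [sSol, etaZero, if_neg this.not_gt, if_neg this.ne', sqrt_mul_sq hq.le]
    rcases abs_cases δ with ⟨h, -⟩ | ⟨h, -⟩
    · rw [h]; field_simp
    · rw [h, mul_neg, Real.sinh_neg]; field_simp

lemma cSol_of_neg {q : ℝ} (hq : q < 0) : cSol q = fun δ => Real.cos (√(-q) * δ) := by
  funext δ
  have h0 : q * δ ^ 2 ≤ 0 := mul_nonpos_of_nonpos_of_nonneg hq.le (sq_nonneg δ)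
  have h1 : |q * δ ^ 2| = -q * δ ^ 2 := by rw [abs_of_nonpos h0]; ring
  rw [cSol, xiFun, if_pos h0, h1, sqrt_mul_sq (by linarith), ← Real.cos_abs (√(-q) * δ), abs_mul,
    abs_of_nonneg (Real.sqrt_nonneg (-q))]

lemma sSol_of_neg {q : ℝ} (hq : q < 0) : sSol q = fun δ => Real.sin (√(-q) * δ) / √(-q) := by
  funext δ
  rcases eq_or_ne δ 0 with rfl | hδ
  · simp [sSol]
  · have h0 : q * δ ^ 2 < 0 := mul_neg_of_neg_of_pos hq (by positivity)
    have h1 : |q * δ ^ 2| = -q * δ ^ 2 := by rw [abs_of_neg h0]; ring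
    have hr : 0 < √(-q) := Real.sqrt_pos.2 (by linarith)
    rw [sSol, etaZero, if_pos h0, h1, sqrt_mul_sq (by linarith)]
    rcases abs_cases δ with ⟨h, -⟩ | ⟨h, -⟩
    · rw [h]; field_simp
    · rw [h, mul_neg, Real.sin_neg]; field_simp

lemma cSol_zero_left : cSol 0 = fun _ => 1 := by funext δ; simp [cSol, xiFun]

lemma sSol_zero_left : sSol 0 = fun δ => δ := by funext δ; simp [sSol, etaZero]

@[simp] lemma cSol_zero (q : ℝ) : cSol q 0 = 1 := by simp [cSol, xiFun]

@[simp] lemma sSol_zero (q : ℝ) : sSol q 0 = 0 := by simp [sSol]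

lemma hasDerivAt_cSol (q δ : ℝ) : HasDerivAt (cSol q) (q * sSol q δ) δ := by
  rcases lt_trichotomy q 0 with hq | rfl | hq
  · have hr : 0 < √(-q) := Real.sqrt_pos.2 (by linarith)
    rw [cSol_of_neg hq, sSol_of_neg hq]
    refine HasDerivAt.congr_deriv (((hasDerivAt_id' δ).const_mul (√(-q))).cos) ?_
    have hsq := Real.mul_self_sqrt (show 0 ≤ -q by linarith)
    field_simp
    linear_combination -Real.sin (√(-q) * δ) * hsq
  · rw [cSol_zero_left, zero_mul]; exact hasDerivAt_const δ 1
  · have hr : 0 < √q := Real.sqrt_pos.2 hq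
    rw [cSol_of_pos hq, sSol_of_pos hq]
    refine HasDerivAt.congr_deriv (((hasDerivAt_id' δ).const_mul (√q)).cosh) ?_
    have hsq := Real.mul_self_sqrt hq.le
    field_simp
    linear_combination Real.sinh (√q * δ) * hsq

lemma hasDerivAt_sSol (q δ : ℝ) : HasDerivAt (sSol q) (cSol q δ) δ := by
  rcases lt_trichotomy q 0 with hq | rfl | hq
  · have hr : 0 < √(-q) := Real.sqrt_pos.2 (by linarith)
    rw [cSol_of_neg hq, sSol_of_neg hq]
    refine HasDerivAt.congr_deriv (((hasDerivAt_id' δ).const_mul (√(-q))).sin.div_const (√(-q))) ?_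
    field_simp
  · rw [cSol_zero_left, sSol_zero_left]; exact hasDerivAt_id δ
  · have hr : 0 < √q := Real.sqrt_pos.2 hq
    rw [cSol_of_pos hq, sSol_of_pos hq]
    refine HasDerivAt.congr_deriv (((hasDerivAt_id' δ).const_mul (√q)).sinh.div_const (√q)) ?_
    field_simp

lemma analyticAt_cSol (q δ : ℝ) : AnalyticAt ℝ (cSol q) δ := by
  rcases lt_trichotomy q 0 with hq | rfl | hq
  · rw [cSol_of_neg hq]; fun_prop
  · rw [cSol_zero_left]; fun_prop
  · rw [cSol_of_pos hq]; fun_prop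

lemma analyticAt_sSol (q δ : ℝ) : AnalyticAt ℝ (sSol q) δ := by
  rcases lt_trichotomy q 0 with hq | rfl | hq
  · rw [sSol_of_neg hq]
    exact AnalyticAt.fun_div (by fun_prop) (by fun_prop) (Real.sqrt_pos.2 (by linarith)).ne'
  · rw [sSol_zero_left]; fun_prop
  · rw [sSol_of_pos hq]
    exact AnalyticAt.fun_div (by fun_prop) (by fun_prop) (Real.sqrt_pos.2 hq).ne'

@[fun_prop]
lemma continuous_cSol (q : ℝ) : Continuous (cSol q) :=
  continuous_iff_continuousAt.2 fun δ => (hasDerivAt_cSol q δ).continuousAt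

@[fun_prop]
lemma continuous_sSol (q : ℝ) : Continuous (sSol q) :=
  continuous_iff_continuousAt.2 fun δ => (hasDerivAt_sSol q δ).continuousAt

lemma cSol_sq_sub (q δ : ℝ) : cSol q δ ^ 2 - q * sSol q δ ^ 2 = 1 := by
  have hd : ∀ t, HasDerivAt (fun t => cSol q t ^ 2 - q * sSol q t ^ 2) 0 t := fun t => by
    refine HasDerivAt.congr_deriv
      (((hasDerivAt_cSol q t).pow 2).sub (((hasDerivAt_sSol q t).pow 2).const_mul q)) ?_
    push_cast; ring
  have := is_const_of_deriv_eq_zero (fun t => (hd t).differentiableAt) (fun t => (hd t).deriv) δ 0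
  simpa using this

lemma cSol_sq_add_sSol_sq_pos (q δ : ℝ) : 0 < cSol q δ ^ 2 + sSol q δ ^ 2 := by
  by_contra! h
  have h1 : cSol q δ ^ 2 = 0 := by nlinarith [sq_nonneg (cSol q δ), sq_nonneg (sSol q δ)]
  have h2 : sSol q δ ^ 2 = 0 := by nlinarith [sq_nonneg (cSol q δ), sq_nonneg (sSol q δ)]
  have := cSol_sq_sub q δ
  rw [h1, h2] at this
  norm_num at this

/-! ### Row-wise symplectic images of `(1, P)` -/

/-- The matrix `diag p + diag r * P`. -/
def affineMat (p r : Fin n → ℝ) (P : Matrix (Fin n) (Fin n) ℝ) : Matrix (Fin n) (Fin n) ℝ :=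
  diagonal p + diagonal r * P

lemma continuous_affineMat {T : Type*} [TopologicalSpace T] {p r : T → Fin n → ℝ}
    (hp : Continuous p) (hr : Continuous r) (P : Matrix (Fin n) (Fin n) ℝ) :
    Continuous fun t => affineMat (p t) (r t) P :=
  hp.matrix_diagonal.add (hr.matrix_diagonal.mul continuous_const)

lemma diagonal_mul_affineMat (f p r : Fin n → ℝ) (P : Matrix (Fin n) (Fin n) ℝ) :
    diagonal f * affineMat p r P = affineMat (fun k => f k * p k) (fun k => f k * r k) P := by
  rw [affineMat, affineMat, mul_add, diagonal_mul_diagonal, ← mul_assoc, diagonal_mul_diagonal]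

/-- The determinant condition makes the diagonal block matrix symplectic, so it carries the
Lagrangian pair `(1, P)` to a Lagrangian pair. -/
lemma affineMat_transpose_mul {p₁ p₂ r₁ r₂ : Fin n → ℝ} {P : Matrix (Fin n) (Fin n) ℝ}
    (h : ∀ k, p₁ k * r₂ k - p₂ k * r₁ k = 1) (hP : P.IsSymm) :
    (affineMat p₁ p₂ P)ᵀ * affineMat r₁ r₂ P = (affineMat r₁ r₂ P)ᵀ * affineMat p₁ p₂ P := by
  have h1 : diagonal p₁ * diagonal r₂ = 1 + diagonal p₂ * diagonal r₁ := by
    rw [diagonal_mul_diagonal, diagonal_mul_diagonal, ← diagonal_one, diagonal_add]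
    congr 1; funext k; linarith [h k]
  have h2 : diagonal r₂ * diagonal p₁ = 1 + diagonal r₁ * diagonal p₂ := by
    rw [diagonal_mul_diagonal, diagonal_mul_diagonal, ← diagonal_one, diagonal_add]
    congr 1; funext k; linarith [h k]
  have h3 : diagonal p₂ * diagonal r₂ = diagonal r₂ * diagonal p₂ := by
    rw [diagonal_mul_diagonal, diagonal_mul_diagonal]; congr 1; funext k; ring
  have h4 : diagonal p₁ * diagonal r₁ = diagonal r₁ * diagonal p₁ := by
    rw [diagonal_mul_diagonal, diagonal_mul_diagonal]; congr 1; funext k; ring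
  have h5 : diagonal p₂ * diagonal r₁ = diagonal r₁ * diagonal p₂ := by
    rw [diagonal_mul_diagonal, diagonal_mul_diagonal]; congr 1; funext k; ring
  simp only [affineMat, transpose_add, transpose_mul, diagonal_transpose, hP.eq]
  calc (diagonal p₁ + P * diagonal p₂) * (diagonal r₁ + diagonal r₂ * P)
      = diagonal p₁ * diagonal r₁ + (diagonal p₁ * diagonal r₂) * P +
        P * (diagonal p₂ * diagonal r₁) + P * (diagonal p₂ * diagonal r₂) * P := by noncomm_ring
    _ = diagonal r₁ * diagonal p₁ + (diagonal r₁ * diagonal p₂) * P +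
        P * (diagonal r₂ * diagonal p₁) + P * (diagonal r₂ * diagonal p₂) * P := by
      rw [h1, h2, h3, h4, h5]; noncomm_ring
    _ = _ := by noncomm_ring

lemma detPlus_affineMat_ne_zero {p₁ p₂ r₁ r₂ : Fin n → ℝ} {P : Matrix (Fin n) (Fin n) ℝ}
    (h : ∀ k, p₁ k * r₂ k - p₂ k * r₁ k = 1) (hP : P.IsSymm) :
    detPlus (affineMat p₁ p₂ P) (affineMat r₁ r₂ P) ≠ 0 := by
  -- These coefficients are the first row of the inverse of the symplectic block matrix, so they
  -- recover the first member `1` of `(1, P)`.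
  refine detPlus_ne_zero (c := diagonal r₂) (d := -diagonal p₂) (affineMat_transpose_mul h hP) ?_
  rw [neg_mul, diagonal_mul_affineMat, diagonal_mul_affineMat]
  simp only [affineMat]
  rw [← sub_eq_add_neg, add_sub_add_comm, ← sub_mul, diagonal_sub, diagonal_sub, ← diagonal_one]
  have h1 : (fun k => r₂ k * p₁ k - p₂ k * r₁ k) = fun _ => 1 := by
    funext k; linarith [h k]
  have h2 : (fun k => r₂ k * p₂ k - p₂ k * r₂ k) = fun _ => 0 := by funext k; ring
  rw [h1, h2]; simp

/-! ### Uniqueness for the equation, and the propagated pair -/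

lemma eq_left_of_hasDerivAt_zero {f : ℝ → ℝ} {x₀ x₁ : ℝ} (hc : ContinuousOn f (uIcc x₀ x₁))
    (hd : ∀ t ∈ uIoo x₀ x₁, HasDerivAt f 0 t) {x : ℝ} (hx : x ∈ uIcc x₀ x₁) : f x = f x₀ := by
  have key : ∀ y z, y ∈ uIcc x₀ x₁ → z ∈ uIcc x₀ x₁ → y < z → f z = f y := by
    intro y z hy hz hyz
    obtain ⟨w, hw, h⟩ := exists_hasDerivAt_eq_slope f (fun _ => 0) hyz
      (hc.mono (Icc_subset_uIcc.trans (uIcc_subset_uIcc hy hz)))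
      (fun t ht => hd t ⟨lt_of_le_of_lt hy.1 ht.1, lt_of_lt_of_le ht.2 hz.2⟩)
    rw [eq_comm, div_eq_zero_iff] at h
    rcases h with h | h <;> linarith
  rcases lt_trichotomy x x₀ with h | h | h
  · exact (key x x₀ hx left_mem_uIcc h).symm
  · rw [h]
  · exact key x₀ x left_mem_uIcc hx h

/-- Solutions of `u'' = q u` are combinations of the fundamental ones. -/
lemma eq_combination_of_hasDerivAt {q x₀ x₁ : ℝ} {u du : ℝ → ℝ}
    (hu : ContinuousOn u (uIcc x₀ x₁)) (hdu : ContinuousOn du (uIcc x₀ x₁))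
    (h : ∀ t ∈ uIoo x₀ x₁, HasDerivAt u (du t) t)
    (h' : ∀ t ∈ uIoo x₀ x₁, HasDerivAt du (q * u t) t) {x : ℝ} (hx : x ∈ uIcc x₀ x₁) :
    u x = cSol q (x - x₀) * u x₀ + sSol q (x - x₀) * du x₀ ∧
      du x = q * sSol q (x - x₀) * u x₀ + cSol q (x - x₀) * du x₀ := by
  have hcd : ∀ t, HasDerivAt (fun t => cSol q (t - x₀)) (q * sSol q (t - x₀)) t := fun t =>
    (hasDerivAt_cSol q (t - x₀)).comp_sub_const t x₀
  have hsd : ∀ t, HasDerivAt (fun t => sSol q (t - x₀)) (cSol q (t - x₀)) t := fun t =>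
    (hasDerivAt_sSol q (t - x₀)).comp_sub_const t x₀
  have hcc : ContinuousOn (fun t => cSol q (t - x₀)) (uIcc x₀ x₁) := by fun_prop
  have hsc : ContinuousOn (fun t => sSol q (t - x₀)) (uIcc x₀ x₁) := by fun_prop
  -- Propagating the data at `t` back to `x₀` gives two conserved quantities; the propagator has
  -- determinant one, so they can be solved for `u x` and `du x`.
  have h1 := eq_left_of_hasDerivAt_zero
    (f := fun t => cSol q (t - x₀) * u t - sSol q (t - x₀) * du t)
    ((hcc.mul hu).sub (hsc.mul hdu))
    (fun t ht => (((hcd t).mul (h t ht)).sub ((hsd t).mul (h' t ht))).congr_deriv (by ring)) hx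
  have h2 := eq_left_of_hasDerivAt_zero
    (f := fun t => cSol q (t - x₀) * du t - q * sSol q (t - x₀) * u t)
    ((hcc.mul hdu).sub ((hsc.const_mul q).mul hu))
    (fun t ht => (((hcd t).mul (h' t ht)).sub (((hsd t).const_mul q).mul (h t ht))).congr_deriv
      (by ring)) hx
  have h3 := cSol_sq_sub q (x - x₀)
  simp only [sub_self, cSol_zero, sSol_zero] at h1 h2
  constructor
  · linear_combination (-u x) * h3 + cSol q (x - x₀) * h1 + sSol q (x - x₀) * h2
  · linear_combination (-du x) * h3 + q * sSol q (x - x₀) * h1 + cSol q (x - x₀) * h2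

/-- The matrix `ξ + (diag q) δ η₀ P`, for `Y'`. -/
def derivMat (q : Fin n → ℝ) (P : Matrix (Fin n) (Fin n) ℝ) (δ : ℝ) : Matrix (Fin n) (Fin n) ℝ :=
  affineMat (fun k => cSol (q k) δ) (fun k => q k * sSol (q k) δ) P

/-- The matrix `δ η₀ + ξ P`, for `Y`. -/
def valueMat (q : Fin n → ℝ) (P : Matrix (Fin n) (Fin n) ℝ) (δ : ℝ) : Matrix (Fin n) (Fin n) ℝ :=
  affineMat (fun k => sSol (q k) δ) (fun k => cSol (q k) δ) P

@[simp] lemma derivMat_zero (q : Fin n → ℝ) (P : Matrix (Fin n) (Fin n) ℝ) :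
    derivMat q P 0 = 1 := by
  simp [derivMat, affineMat]

@[simp] lemma valueMat_zero (q : Fin n → ℝ) (P : Matrix (Fin n) (Fin n) ℝ) :
    valueMat q P 0 = P := by
  simp [valueMat, affineMat]

lemma continuous_derivMat (q : Fin n → ℝ) (P : Matrix (Fin n) (Fin n) ℝ) :
    Continuous (derivMat q P) := continuous_affineMat (by fun_prop) (by fun_prop) P

lemma continuous_valueMat (q : Fin n → ℝ) (P : Matrix (Fin n) (Fin n) ℝ) :
    Continuous (valueMat q P) := continuous_affineMat (by fun_prop) (by fun_prop) P

lemma wronskian (q : Fin n → ℝ) (δ : ℝ) (k : Fin n) :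
    cSol (q k) δ * cSol (q k) δ - q k * sSol (q k) δ * sSol (q k) δ = 1 := by
  linear_combination cSol_sq_sub (q k) δ

/-! ### Density of regular points and agreement modulo `π` -/

lemma analyticAt_det_derivMat (q : Fin n → ℝ) (P : Matrix (Fin n) (Fin n) ℝ) (δ : ℝ) :
    AnalyticAt ℝ (fun δ => (derivMat q P δ).det) δ := by
  have hentry : ∀ i j, AnalyticAt ℝ (fun δ => derivMat q P δ i j) δ := fun i j => by
    have hc := analyticAt_cSol (q i) δ
    have hs := analyticAt_sSol (q i) δ
    by_cases h : i = j
    · subst h; simp only [derivMat, affineMat, Matrix.add_apply, diagonal_mul, diagonal_apply_eq]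
      fun_prop
    · simp only [derivMat, affineMat, Matrix.add_apply, diagonal_mul, diagonal_apply_ne _ h]
      fun_prop
  simp only [det_apply, Units.smul_def, zsmul_eq_mul]
  refine Finset.analyticAt_fun_sum _ fun σ _ => analyticAt_const.mul ?_
  exact Finset.analyticAt_fun_prod _ fun i _ => hentry _ _

open Filter Topology in
-- Zeros of `h` are isolated because `h 0 ≠ 0`, and any point other than `x₀` can be approached from
-- inside the interval along the segment towards `x₀`.
lemma uIcc_subset_closure_of_analytic {h : ℝ → ℝ} (ha : ∀ t, AnalyticAt ℝ h t) (h0 : h 0 ≠ 0)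
    {x₀ x₁ : ℝ} {R : Set ℝ} (hR : ∀ t ∈ uIcc x₀ x₁, h (t - x₀) ≠ 0 → t ∈ R) :
    uIcc x₀ x₁ ⊆ closure (uIcc x₀ x₁ ∩ R) := by
  intro t ht
  by_cases hne : h (t - x₀) = 0
  swap
  · exact subset_closure ⟨ht, hR t ht hne⟩
  have htx : t ≠ x₀ := by rintro rfl; simp [h0] at hne
  have hev : ∀ᶠ y in 𝓝[≠] (t - x₀), h y ≠ 0 := by
    refine (ha (t - x₀)).eventually_eq_zero_or_eventually_ne_zero.resolve_left fun hz => h0 ?_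
    exact AnalyticOnNhd.eqOn_zero_of_preconnected_of_eventuallyEq_zero (U := univ)
      (fun t _ => ha t) isPreconnected_univ (mem_univ _) hz (mem_univ 0)
  have hlim : Tendsto (fun ε : ℝ => t + ε * (x₀ - t)) (𝓝[>] 0) (𝓝 t) := by
    have : Continuous fun ε : ℝ => t + ε * (x₀ - t) := by fun_prop
    simpa using (this.tendsto 0).mono_left nhdsWithin_le_nhds
  have hlim' : Tendsto (fun ε : ℝ => t + ε * (x₀ - t) - x₀) (𝓝[>] 0) (𝓝[≠] (t - x₀)) := by
    refine tendsto_nhdsWithin_iff.2 ⟨hlim.sub_const x₀, ?_⟩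
    filter_upwards [self_mem_nhdsWithin] with ε hε
    have h1 : ε * (x₀ - t) ≠ 0 := mul_ne_zero (ne_of_gt hε) (sub_ne_zero.2 htx.symm)
    intro h2
    apply h1
    simp only [mem_singleton_iff] at h2
    linarith
  refine mem_closure_of_tendsto hlim ?_
  filter_upwards [hlim'.eventually hev, Ioo_mem_nhdsGT (zero_lt_one (α := ℝ))] with ε h1 h2
  have hmem : t + ε * (x₀ - t) ∈ uIcc x₀ x₁ := by
    have := (convex_uIcc x₀ x₁).add_smul_sub_mem ht left_mem_uIcc ⟨h2.1.le, h2.2.le⟩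
    simpa using this
  exact ⟨hmem, hR _ hmem h1⟩

/-- Continuous functions that agree modulo `π` on a dense subset of a connected set differ by a
constant. -/
lemma sub_eq_sub_of_expTwo_eq {T : Type*} [TopologicalSpace T] {J R : Set T} (hJ : IsPreconnected J)
    (hR : J ⊆ closure (J ∩ R)) {f g : T → ℝ} (hf : ContinuousOn f J) (hg : ContinuousOn g J)
    (h : ∀ t ∈ J, t ∈ R → expTwo (f t) = expTwo (g t)) {x y : T} (hx : x ∈ J) (hy : y ∈ J) :
    f x - g x = f y - g y := by
  have heq : EqOn (fun t => expTwo (f t)) (fun t => expTwo (g t)) J :=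
    EqOn.of_subset_closure (fun t ht => h t ht.1 ht.2) (continuous_expTwo.comp_continuousOn hf)
      (continuous_expTwo.comp_continuousOn hg) inter_subset_left hR
  have hd : IsDiscrete (range ((↑) : ℤ → ℝ)) :=
    Int.isClosedEmbedding_coe_real.isInducing.isDiscrete_range
  have hmaps : MapsTo (fun t => (f t - g t) / Real.pi) J (range ((↑) : ℤ → ℝ)) := fun t ht => by
    obtain ⟨k, hk⟩ := expTwo_eq_iff.1 (heq ht)
    refine ⟨k, ?_⟩
    simp only
    rw [hk]
    field_simp
    ring
  have := hJ.constant_of_mapsTo hd ((hf.sub hg).div_const _) hmaps hx hy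
  simpa [Real.pi_ne_zero, div_left_inj'] using this

/-! ### The matrices of the statement as pairs -/

lemma xiMat_eq (v : Fin n → ℝ) (E δ : ℝ) :
    xiMat v E δ = diagonal fun k => cSol (v k - E) δ := rfl

lemma smul_etaMat_eq (v : Fin n → ℝ) (E δ : ℝ) :
    δ • etaMat v E δ = diagonal fun k => sSol (v k - E) δ := by
  rw [etaMat, ← diagonal_smul]; rfl

lemma omegaDen_eq (v : Fin n → ℝ) (E δ : ℝ) (P : Matrix (Fin n) (Fin n) ℝ) :
    omegaDen v E δ P =
      affineMat (fun k => cSol (v k - E) δ) (fun k => -sSol (v k - E) δ) P := by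
  rw [omegaDen, smul_etaMat_eq, xiMat_eq, affineMat, sub_eq_add_neg, ← neg_mul, diagonal_neg]

lemma omega_eq (v : Fin n → ℝ) (E δ : ℝ) (P : Matrix (Fin n) (Fin n) ℝ) :
    omega v E δ P = (omegaDen v E δ P)⁻¹ * valueMat (fun k => v k - E) P δ := by
  rw [omega, smul_etaMat_eq, xiMat_eq, add_comm]; rfl

lemma isUnit_xiMat_iff {v : Fin n → ℝ} {E δ : ℝ} :
    IsUnit (xiMat v E δ) ↔ ∀ k, cSol (v k - E) δ ≠ 0 := by
  rw [Matrix.isUnit_iff_isUnit_det, xiMat_eq, det_diagonal, isUnit_iff_ne_zero,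
    Finset.prod_ne_zero_iff]
  simp

lemma fMat_eq {v : Fin n → ℝ} {E δ : ℝ} (h : ∀ k, cSol (v k - E) δ ≠ 0) :
    fMat v E δ = diagonal fun k => (cSol (v k - E) δ)⁻¹ * sSol (v k - E) δ := by
  have hinv : (xiMat v E δ)⁻¹ = diagonal fun k => (cSol (v k - E) δ)⁻¹ := by
    refine Matrix.inv_eq_left_inv ?_
    rw [xiMat_eq, diagonal_mul_diagonal, ← diagonal_one]
    congr 1; funext k; exact inv_mul_cancel₀ (h k)
  rw [fMat, ← Matrix.mul_smul, smul_etaMat_eq, hinv, diagonal_mul_diagonal]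

lemma derivMat_zero_right (v : Fin n → ℝ) (E δ : ℝ) :
    derivMat (fun k => v k - E) 0 δ = xiMat v E δ := by
  rw [derivMat, affineMat, mul_zero, add_zero, xiMat_eq]

/-- Thus `F` is the propagated quotient with initial value `P = 0`, and its phases come from the
same construction as those of `Ψᴰ`. -/
lemma valueMat_mul_inv_zero_right {v : Fin n → ℝ} {E δ : ℝ} (h : IsUnit (xiMat v E δ)) :
    valueMat (fun k => v k - E) 0 δ * (derivMat (fun k => v k - E) 0 δ)⁻¹ = fMat v E δ := by
  rw [derivMat_zero_right, valueMat, affineMat, mul_zero, add_zero, fMat, ← Matrix.mul_smul,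
    smul_etaMat_eq]
  have hd := (Matrix.isUnit_iff_isUnit_det _).1 h
  have hcomm : diagonal (fun k => sSol (v k - E) δ) * xiMat v E δ =
      xiMat v E δ * diagonal fun k => sSol (v k - E) δ := by
    rw [xiMat_eq, diagonal_mul_diagonal, diagonal_mul_diagonal]; congr 1; funext k; ring
  calc _ = (xiMat v E δ)⁻¹ * (xiMat v E δ * diagonal fun k => sSol (v k - E) δ) *
        (xiMat v E δ)⁻¹ := by rw [← mul_assoc, Matrix.nonsing_inv_mul _ hd, one_mul]
    _ = _ := by
      rw [← hcomm, mul_assoc, mul_assoc, Matrix.mul_nonsing_inv _ hd, mul_one]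

lemma HasPhases.mul_inv {a b : Matrix (Fin n) (Fin n) ℝ} {α : Fin n → ℝ} (h : HasPhases a b α)
    (ha : IsUnit a) : HasPhases 1 (b * a⁻¹) α := by
  have := h.mul_mul isUnit_one ((Matrix.isUnit_nonsing_inv_iff).2 ha)
  rwa [one_mul, one_mul, Matrix.mul_nonsing_inv _ ((Matrix.isUnit_iff_isUnit_det _).1 ha)] at this

lemma EigenvaluesAreTan.hasPhases_of_mul_inv {a b : Matrix (Fin n) (Fin n) ℝ} {α : Fin n → ℝ}
    (ha : IsUnit a) (h : EigenvaluesAreTan (b * a⁻¹) α) : HasPhases a b α := by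
  have := h.hasPhases.mul_mul isUnit_one ha
  rwa [one_mul, one_mul, one_mul, mul_assoc,
    Matrix.nonsing_inv_mul _ ((Matrix.isUnit_iff_isUnit_det _).1 ha), mul_one] at this

lemma HasPhases.eigenvaluesAreTan {a b : Matrix (Fin n) (Fin n) ℝ} {α : Fin n → ℝ}
    (h : HasPhases a b α) (hs : aᵀ * b = bᵀ * a) (ha : IsUnit a) :
    EigenvaluesAreTan (b * a⁻¹) α := by
  obtain ⟨β, -, hβ⟩ := exists_eigenvaluesAreTan (isSymm_mul_inv hs ha)
  exact eigenvaluesAreTan_of_hasPhases hβ (h.mul_inv ha)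

lemma derivMat_transpose_mul (q : Fin n → ℝ) {P : Matrix (Fin n) (Fin n) ℝ} (hP : P.IsSymm)
    (δ : ℝ) : (derivMat q P δ)ᵀ * valueMat q P δ = (valueMat q P δ)ᵀ * derivMat q P δ :=
  affineMat_transpose_mul (wronskian q δ) hP

/-- Continuous ordered phases of the pair `(Y', Y)`. -/
lemma exists_phases_of_symm [NeZero n] (q : Fin n → ℝ) {P : Matrix (Fin n) (Fin n) ℝ}
    (hP : P.IsSymm) {φ₀ : Fin n → ℝ} (ho : AnglesOrdered φ₀) (h : EigenvaluesAreTan P φ₀) :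
    ∃ φ : ℝ → Fin n → ℝ, Continuous φ ∧
      (∀ δ, HasPhases (derivMat q P δ) (valueMat q P δ) (φ δ)) ∧
      (∀ δ, AnglesOrdered (φ δ)) ∧ φ 0 = φ₀ := by
  have h0 : HasPhases (derivMat q P 0) (valueMat q P 0) φ₀ := by simpa using h.hasPhases
  obtain ⟨φ, h1, h2, h3, h4⟩ := exists_continuous_phases (continuous_derivMat q P)
    (continuous_valueMat q P) (derivMat_transpose_mul q hP)
    (fun δ => detPlus_affineMat_ne_zero (wronskian q δ) hP) 0 h0.detPlus_eq
  exact ⟨φ, h1, h2, h3, (h2 0).eq_of_sum_eq h0 (h3 0) ho h4⟩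

/-! ### The homotopy from `(Y', Y)` to the pair of `Ω` -/

/-- The amplitude `√(ξ² + δ² η₀²)`. -/
def amplitude (q δ : ℝ) : ℝ := √(cSol q δ ^ 2 + sSol q δ ^ 2)

lemma amplitude_pos (q δ : ℝ) : 0 < amplitude q δ := Real.sqrt_pos.2 (cSol_sq_add_sSol_sq_pos q δ)

lemma amplitude_sq (q δ : ℝ) : amplitude q δ ^ 2 = cSol q δ ^ 2 + sSol q δ ^ 2 :=
  Real.sq_sqrt (cSol_sq_add_sSol_sq_pos q δ).le

@[simp] lemma amplitude_zero (q : ℝ) : amplitude q 0 = 1 := by simp [amplitude]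

@[fun_prop]
lemma continuous_amplitude (q : ℝ) : Continuous (amplitude q) := by
  unfold amplitude; fun_prop

/-- The power `R ^ s` of the amplitude `R`. -/
def scaling (q δ s : ℝ) : ℝ := Real.exp (s * Real.log (amplitude q δ))

lemma scaling_neg (q δ s : ℝ) : scaling q δ (-s) * scaling q δ s = 1 := by
  rw [scaling, scaling, ← Real.exp_add]; simp

lemma scaling_zero_right (q δ : ℝ) : scaling q δ 0 = 1 := by simp [scaling]

lemma scaling_zero_left (q s : ℝ) : scaling q 0 s = 1 := by simp [scaling]

lemma scaling_one (q δ : ℝ) : scaling q δ 1 = amplitude q δ := by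
  rw [scaling, one_mul, Real.exp_log (amplitude_pos q δ)]

lemma scaling_neg_one (q δ : ℝ) : scaling q δ (-1) = (amplitude q δ)⁻¹ := by
  have := scaling_neg q δ 1
  rw [scaling_one] at this
  exact eq_inv_of_mul_eq_one_left this

/-- The shear of the homotopy, `(q + 1) ξ δ η₀ / R`. -/
def shear (q δ : ℝ) : ℝ := (q + 1) * sSol q δ * cSol q δ / amplitude q δ

/-- The first member of a homotopy of Lagrangian pairs from `(Y', Y)` to the pair of `Ω`; the
parameter is `(δ, λ)`. -/
def homotopyDeriv (q : Fin n → ℝ) (P : Matrix (Fin n) (Fin n) ℝ) (t : ℝ × ℝ) :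
    Matrix (Fin n) (Fin n) ℝ :=
  affineMat
    (fun k => scaling (q k) t.1 t.2 * cSol (q k) t.1 - t.2 * shear (q k) t.1 * sSol (q k) t.1)
    (fun k => scaling (q k) t.1 t.2 * (q k * sSol (q k) t.1) -
      t.2 * shear (q k) t.1 * cSol (q k) t.1) P

/-- The second member of the homotopy. -/
def homotopyValue (q : Fin n → ℝ) (P : Matrix (Fin n) (Fin n) ℝ) (t : ℝ × ℝ) :
    Matrix (Fin n) (Fin n) ℝ :=
  affineMat (fun k => scaling (q k) t.1 (-t.2) * sSol (q k) t.1)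
    (fun k => scaling (q k) t.1 (-t.2) * cSol (q k) t.1) P

lemma homotopyValue_eq (q : Fin n → ℝ) (P : Matrix (Fin n) (Fin n) ℝ) (t : ℝ × ℝ) :
    homotopyValue q P t =
      (diagonal fun k => scaling (q k) t.1 (-t.2)) * valueMat q P t.1 := by
  rw [valueMat, diagonal_mul_affineMat, homotopyValue]

/-- This independence of the second parameter is the purpose of the homotopy's form: it keeps the
number of phases in `πℤ` fixed. -/
lemma rank_homotopyValue (q : Fin n → ℝ) (P : Matrix (Fin n) (Fin n) ℝ) (t : ℝ × ℝ) :
    (homotopyValue q P t).rank = (valueMat q P t.1).rank := by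
  rw [homotopyValue_eq, Matrix.rank_mul_eq_right_of_isUnit_det]
  rw [det_diagonal, isUnit_iff_ne_zero, Finset.prod_ne_zero_iff]
  exact fun k _ => (Real.exp_pos _).ne'

lemma continuous_homotopyDeriv (q : Fin n → ℝ) (P : Matrix (Fin n) (Fin n) ℝ) :
    Continuous (homotopyDeriv q P) := by
  have hs : ∀ k, Continuous fun t : ℝ × ℝ => scaling (q k) t.1 t.2 := fun k => by
    unfold scaling
    exact Real.continuous_exp.comp (continuous_snd.mul
      (((continuous_amplitude _).comp continuous_fst).log fun t => (amplitude_pos _ _).ne'))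
  have hsh : ∀ k, Continuous fun t : ℝ × ℝ => shear (q k) t.1 := fun k => by
    unfold shear
    exact Continuous.div (by fun_prop) (by fun_prop) fun t => (amplitude_pos _ _).ne'
  exact continuous_affineMat (by fun_prop) (by fun_prop) P

lemma continuous_homotopyValue (q : Fin n → ℝ) (P : Matrix (Fin n) (Fin n) ℝ) :
    Continuous (homotopyValue q P) := by
  have hs : ∀ k, Continuous fun t : ℝ × ℝ => scaling (q k) t.1 (-t.2) := fun k => by
    unfold scaling
    exact Real.continuous_exp.comp (continuous_snd.neg.mul
      (((continuous_amplitude _).comp continuous_fst).log fun t => (amplitude_pos _ _).ne'))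
  exact continuous_affineMat (by fun_prop) (by fun_prop) P

/-- The reciprocal scalings cancel, and the shear subtracts from the first row a multiple of the
second, so the determinant stays that of the propagator. -/
lemma homotopy_wronskian (q : Fin n → ℝ) (t : ℝ × ℝ) (k : Fin n) :
    (scaling (q k) t.1 t.2 * cSol (q k) t.1 - t.2 * shear (q k) t.1 * sSol (q k) t.1) *
      (scaling (q k) t.1 (-t.2) * cSol (q k) t.1) -
    (scaling (q k) t.1 t.2 * (q k * sSol (q k) t.1) - t.2 * shear (q k) t.1 * cSol (q k) t.1) *
      (scaling (q k) t.1 (-t.2) * sSol (q k) t.1) = 1 := by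
  linear_combination cSol_sq_sub (q k) t.1 + (cSol (q k) t.1 ^ 2 - q k * sSol (q k) t.1 ^ 2) *
    scaling_neg (q k) t.1 t.2

lemma homotopyDeriv_zero_right (q : Fin n → ℝ) (P : Matrix (Fin n) (Fin n) ℝ) (δ : ℝ) :
    homotopyDeriv q P (δ, 0) = derivMat q P δ := by
  simp [homotopyDeriv, derivMat, scaling_zero_right]

lemma homotopyValue_zero_right (q : Fin n → ℝ) (P : Matrix (Fin n) (Fin n) ℝ) (δ : ℝ) :
    homotopyValue q P (δ, 0) = valueMat q P δ := by
  simp [homotopyValue, valueMat, scaling_zero_right]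

lemma homotopyDeriv_zero_left (q : Fin n → ℝ) (P : Matrix (Fin n) (Fin n) ℝ) (s : ℝ) :
    homotopyDeriv q P (0, s) = 1 := by
  simp [homotopyDeriv, scaling_zero_left, affineMat, shear]

lemma homotopyValue_zero_left (q : Fin n → ℝ) (P : Matrix (Fin n) (Fin n) ℝ) (s : ℝ) :
    homotopyValue q P (0, s) = P := by
  simp [homotopyValue, scaling_zero_left, affineMat]

/-- The shear is tuned for this endpoint: with `c = ξ`, `s = δ η₀`, `R² = c² + s²` and `c² - q s² =
1`, one has `R² c - (q + 1) s² c = c` and `R² q s - (q + 1) s c² = -s`. -/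
lemma homotopyDeriv_one_right (q : Fin n → ℝ) (P : Matrix (Fin n) (Fin n) ℝ) (δ : ℝ) :
    homotopyDeriv q P (δ, 1) = (diagonal fun k => (amplitude (q k) δ)⁻¹) *
      affineMat (fun k => cSol (q k) δ) (fun k => -sSol (q k) δ) P := by
  rw [diagonal_mul_affineMat, homotopyDeriv]
  congr 1 <;> funext k
  all_goals
    have h1 := amplitude_sq (q k) δ
    have h2 := cSol_sq_sub (q k) δ
    have h3 := amplitude_pos (q k) δ
    simp only [scaling_one, shear]
    field_simp
  · linear_combination (cSol (q k) δ) * h1 + (cSol (q k) δ) * h2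
  · linear_combination (q k * sSol (q k) δ) * h1 - sSol (q k) δ * h2

lemma homotopyValue_one_right (q : Fin n → ℝ) (P : Matrix (Fin n) (Fin n) ℝ) (δ : ℝ) :
    homotopyValue q P (δ, 1) = (diagonal fun k => (amplitude (q k) δ)⁻¹) * valueMat q P δ := by
  rw [homotopyValue_eq]; simp only [scaling_neg_one]

/-- The matrix form of the addition theorem of the tangent. -/
lemma det_addition (W F P : Matrix (Fin n) (Fin n) ℝ) :
    detPlus (W * (1 - F * P)) (W * (F + P)) = (toC W).det * detPlus 1 F * detPlus 1 P ∧
      detMinus (W * (1 - F * P)) (W * (F + P)) = (toC W).det * detMinus 1 F * detMinus 1 P := by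
  have h1 : toC (W * (1 - F * P)) + Complex.I • toC (W * (F + P)) =
      toC W * (toC 1 + Complex.I • toC F) * (toC 1 + Complex.I • toC P) := by
    simp only [map_mul, map_sub, map_add, map_one, mul_add, add_mul, mul_sub, mul_one,
      Matrix.smul_mul, Matrix.mul_smul, smul_smul, Complex.I_mul_I, mul_assoc]
    module
  have h2 : toC (W * (1 - F * P)) - Complex.I • toC (W * (F + P)) =
      toC W * (toC 1 - Complex.I • toC F) * (toC 1 - Complex.I • toC P) := by
    simp only [map_mul, map_sub, map_add, map_one, mul_add, sub_mul, mul_sub, mul_one,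
      Matrix.smul_mul, Matrix.mul_smul, smul_smul, Complex.I_mul_I, mul_assoc]
    module
  constructor
  · rw [detPlus, h1, det_mul, det_mul, detPlus, detPlus]
  · rw [detMinus, h2, det_mul, det_mul, detMinus, detMinus]

lemma isUnit_amplitude_inv (q : Fin n → ℝ) (δ : ℝ) :
    IsUnit (diagonal fun k => (amplitude (q k) δ)⁻¹ : Matrix (Fin n) (Fin n) ℝ) := by
  rw [Matrix.isUnit_iff_isUnit_det, det_diagonal, isUnit_iff_ne_zero, Finset.prod_ne_zero_iff]
  exact fun k _ => inv_ne_zero (amplitude_pos _ _).ne'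

lemma expTwo_sum_homotopy_one {v : Fin n → ℝ} {E δ : ℝ} {P : Matrix (Fin n) (Fin n) ℝ}
    (hc : ∀ k, cSol (v k - E) δ ≠ 0) {α θ φ₀ : Fin n → ℝ}
    (hα : HasPhases (homotopyDeriv (fun k => v k - E) P (δ, 1))
      (homotopyValue (fun k => v k - E) P (δ, 1)) α)
    (hθ : EigenvaluesAreTan (fMat v E δ) θ) (hφ : HasPhases 1 P φ₀) :
    expTwo (∑ j, α j) = expTwo (∑ j, θ j) * expTwo (∑ j, φ₀ j) := by
  -- With `W = R⁻¹ ξ` the endpoint pair becomes `(W (1 - F P), W (F + P))`, the form required by the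
  -- addition theorem.
  set W : Matrix (Fin n) (Fin n) ℝ :=
    diagonal fun k => (amplitude (v k - E) δ)⁻¹ * cSol (v k - E) δ with hW
  have hF := fMat_eq hc
  have hA : homotopyDeriv (fun k => v k - E) P (δ, 1) = W * (1 - fMat v E δ * P) := by
    rw [homotopyDeriv_one_right, diagonal_mul_affineMat, mul_sub, mul_one, ← mul_assoc, hF, hW,
      diagonal_mul_diagonal, affineMat, sub_eq_add_neg, ← neg_mul, diagonal_neg]
    congr 3
    funext k
    have := hc k
    field_simp
  have hB : homotopyValue (fun k => v k - E) P (δ, 1) = W * (fMat v E δ + P) := by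
    rw [homotopyValue_one_right, valueMat, diagonal_mul_affineMat, mul_add, hF, hW,
      diagonal_mul_diagonal, affineMat]
    congr 2
    funext k
    have := hc k
    field_simp
  have hdet := det_addition W (fMat v E δ) P
  rw [← hA, ← hB] at hdet
  have h1 := hα.detPlus_eq
  rw [hdet.1, hdet.2, hθ.hasPhases.detPlus_eq, hφ.detPlus_eq] at h1
  have hne := hα.1
  rw [hdet.2] at hne
  apply mul_left_cancel₀ hne
  rw [← h1]; ring

lemma EigenvaluesAreTan.hasPhases_homotopy_one {v : Fin n → ℝ} {E δ : ℝ}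
    {P : Matrix (Fin n) (Fin n) ℝ} (hu : IsUnit (omegaDen v E δ P)) {τ : Fin n → ℝ}
    (h : EigenvaluesAreTan (omega v E δ P) τ) :
    HasPhases (homotopyDeriv (fun k => v k - E) P (δ, 1))
      (homotopyValue (fun k => v k - E) P (δ, 1)) τ := by
  have := h.hasPhases.mul_mul ((isUnit_amplitude_inv (fun k => v k - E) δ).mul hu) isUnit_one
  rw [mul_one, mul_one, mul_one, omega_eq, mul_assoc _ (omegaDen v E δ P), ← mul_assoc _ _⁻¹,
    Matrix.mul_nonsing_inv _ ((Matrix.isUnit_iff_isUnit_det _).1 hu), one_mul, omegaDen_eq] at this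
  rwa [homotopyDeriv_one_right, homotopyValue_one_right]

/-- `Ω` need not be symmetric. The quotient of the homotopy pair at `λ = 1` is, and exchanging its
two factors, which preserves the characteristic polynomial, cancels the amplitudes and gives `Ω`. -/
lemma exists_eigenvaluesAreTan_omega {v : Fin n → ℝ} {E δ : ℝ} {P : Matrix (Fin n) (Fin n) ℝ}
    (hP : P.IsSymm) (hu : IsUnit (omegaDen v E δ P)) :
    ∃ τ : Fin n → ℝ, (∀ j, τ j ∈ Ico 0 Real.pi) ∧ EigenvaluesAreTan (omega v E δ P) τ := by
  set q : Fin n → ℝ := fun k => v k - E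
  have hs : (homotopyDeriv q P (δ, 1))ᵀ * homotopyValue q P (δ, 1) =
      (homotopyValue q P (δ, 1))ᵀ * homotopyDeriv q P (δ, 1) :=
    affineMat_transpose_mul (homotopy_wronskian q (δ, 1)) hP
  have ha : homotopyDeriv q P (δ, 1) =
      (diagonal fun k => (amplitude (q k) δ)⁻¹) * omegaDen v E δ P := by
    rw [homotopyDeriv_one_right, omegaDen_eq]
  have hau : IsUnit (homotopyDeriv q P (δ, 1)) := by
    rw [ha]; exact (isUnit_amplitude_inv q δ).mul hu
  obtain ⟨τ, h1, h2, h3⟩ := exists_eigenvaluesAreTan (isSymm_mul_inv hs hau)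
  refine ⟨τ, h1, h2, ?_⟩
  rw [← h3, Matrix.charpoly_mul_comm, ha, homotopyValue_one_right, Matrix.mul_inv_rev, mul_assoc,
    ← mul_assoc _⁻¹ _ (valueMat q P δ),
    Matrix.nonsing_inv_mul _ ((Matrix.isUnit_iff_isUnit_det _).1 (isUnit_amplitude_inv q δ)),
    one_mul, omega_eq]

/-! ### From the matrix solution to the propagated pair -/

lemma transpose_eq_inv {D : Matrix (Fin n) (Fin n) ℝ}
    (hD : D ∈ Matrix.orthogonalGroup (Fin n) ℝ) : Dᵀ = D⁻¹ :=
  (Matrix.inv_eq_right_inv ((Matrix.mem_orthogonalGroup_iff (Fin n) ℝ).1 hD)).symm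

lemma isUnit_of_orthogonal {D : Matrix (Fin n) (Fin n) ℝ}
    (hD : D ∈ Matrix.orthogonalGroup (Fin n) ℝ) : IsUnit D :=
  IsUnit.of_mul_eq_one _ ((Matrix.mem_orthogonalGroup_iff (Fin n) ℝ).1 hD)

lemma transpose_mul_self_of_orthogonal {D : Matrix (Fin n) (Fin n) ℝ}
    (hD : D ∈ Matrix.orthogonalGroup (Fin n) ℝ) : Dᵀ * D = 1 :=
  (Matrix.mem_orthogonalGroup_iff' (Fin n) ℝ).1 hD

lemma psiD_eq {D : Matrix (Fin n) (Fin n) ℝ} (hD : D ∈ Matrix.orthogonalGroup (Fin n) ℝ)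
    (Y dY : ℝ → Matrix (Fin n) (Fin n) ℝ) (t : ℝ) :
    psiD D Y dY t = (Dᵀ * Y t) * (Dᵀ * dY t)⁻¹ := by
  rw [Matrix.mul_inv_rev, transpose_eq_inv hD, Matrix.nonsing_inv_nonsing_inv _
    ((Matrix.isUnit_iff_isUnit_det _).1 (isUnit_of_orthogonal hD)), psiD, psi]
  simp only [mul_assoc]

lemma isSymm_psiD {D : Matrix (Fin n) (Fin n) ℝ} (hD : D ∈ Matrix.orthogonalGroup (Fin n) ℝ)
    {Y dY : ℝ → Matrix (Fin n) (Fin n) ℝ} {t : ℝ} (h : (psi Y dY t).IsSymm) :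
    (psiD D Y dY t).IsSymm := by
  rw [IsSymm, psiD, ← transpose_eq_inv hD, transpose_mul, transpose_mul, h.eq,
    transpose_transpose, mul_assoc]

/-- The solution in terms of its logarithmic derivative at the start of the step. -/
lemma IsSolution.eq_mul {V : ℝ → Matrix (Fin n) (Fin n) ℝ} {D : Matrix (Fin n) (Fin n) ℝ}
    {v : Fin n → ℝ} {E x₀ x₁ : ℝ} {Y dY : ℝ → Matrix (Fin n) (Fin n) ℝ}
    (hD : D ∈ Matrix.orthogonalGroup (Fin n) ℝ)
    (hV : ∀ t ∈ Set.uIoo x₀ x₁, V t = D * Matrix.diagonal v * D.transpose)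
    (hY : IsSolution V E x₀ x₁ Y dY) (hreg : IsUnit (dY x₀)) {t : ℝ} (ht : t ∈ uIcc x₀ x₁) :
    Dᵀ * Y t = valueMat (fun k => v k - E) (psiD D Y dY x₀) (t - x₀) * (Dᵀ * dY x₀) ∧
      Dᵀ * dY t = derivMat (fun k => v k - E) (psiD D Y dY x₀) (t - x₀) * (Dᵀ * dY x₀) := by
  have hu : IsUnit (Dᵀ * dY x₀) := by
    rw [transpose_eq_inv hD]
    exact (Matrix.isUnit_nonsing_inv_iff.2 (isUnit_of_orthogonal hD)).mul hreg
  have hP : psiD D Y dY x₀ * (Dᵀ * dY x₀) = Dᵀ * Y x₀ := by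
    rw [psiD_eq hD, mul_assoc, Matrix.nonsing_inv_mul _ ((Matrix.isUnit_iff_isUnit_det _).1 hu),
      mul_one]
  have hmul : ∀ (Z dZ : ℝ → Matrix (Fin n) (Fin n) ℝ) (s : ℝ),
      (∀ j k, HasDerivAt (fun s => Z s j k) (dZ s j k) s) →
      ∀ j k, HasDerivAt (fun s => (Dᵀ * Z s) j k) ((Dᵀ * dZ s) j k) s := by
    intro Z dZ s h j k
    simp only [Matrix.mul_apply]
    exact HasDerivAt.fun_sum fun i _ => (h i k).const_mul _
  -- Multiplication by `Dᵀ` decouples the system: every entry of row `j` solves `u'' = (v j - E) u`.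
  have hacc : ∀ s ∈ uIoo x₀ x₁, Dᵀ * ((V s - E • (1 : Matrix (Fin n) (Fin n) ℝ)) * Y s) =
      (diagonal fun k => v k - E) * (Dᵀ * Y s) := by
    intro s hs
    have h1 : (diagonal fun k => v k - E) = diagonal v - E • (1 : Matrix (Fin n) (Fin n) ℝ) := by
      rw [smul_one_eq_diagonal, diagonal_sub]
    have h2 := transpose_mul_self_of_orthogonal hD
    rw [hV s hs, h1, sub_mul, sub_mul, mul_sub, Matrix.smul_mul, Matrix.smul_mul, one_mul, one_mul,
      Matrix.mul_smul]
    congr 1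
    rw [← mul_assoc, ← mul_assoc, ← mul_assoc, h2, one_mul, mul_assoc]
  have hcont : ∀ Z : ℝ → Matrix (Fin n) (Fin n) ℝ, ContinuousOn Z (uIcc x₀ x₁) → ∀ j k,
      ContinuousOn (fun s => (Dᵀ * Z s) j k) (uIcc x₀ x₁) := by
    intro Z hZ j k
    have : Continuous fun M : Matrix (Fin n) (Fin n) ℝ => (Dᵀ * M) j k := by fun_prop
    exact this.comp_continuousOn hZ
  have key : ∀ j k, _ := fun j k => eq_combination_of_hasDerivAt (q := v j - E)
    (hcont Y hY.continuousOn j k) (hcont dY hY.continuousOn_deriv j k)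
    (fun s hs => hmul Y dY s (hY.hasDerivAt s hs) j k)
    (fun s hs => (hmul dY (fun s => (V s - E • (1 : Matrix (Fin n) (Fin n) ℝ)) * Y s) s
      (hY.hasDerivAt_deriv s hs) j k).congr_deriv
        (by rw [hacc s hs, diagonal_mul])) ht
  constructor
  · ext j k
    rw [valueMat, affineMat, add_mul, mul_assoc, hP, Matrix.add_apply, diagonal_mul, diagonal_mul,
      (key j k).1]
    ring
  · ext j k
    rw [derivMat, affineMat, add_mul, mul_assoc, hP, Matrix.add_apply, diagonal_mul, diagonal_mul,
      (key j k).2]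
    ring

/-- `Ψᴰ` and its domain in terms of the value at the start of the step. -/
lemma IsSolution.psiD_eq_mul_inv {V : ℝ → Matrix (Fin n) (Fin n) ℝ}
    {D : Matrix (Fin n) (Fin n) ℝ}
    {v : Fin n → ℝ} {E x₀ x₁ : ℝ} {Y dY : ℝ → Matrix (Fin n) (Fin n) ℝ}
    (hD : D ∈ Matrix.orthogonalGroup (Fin n) ℝ)
    (hV : ∀ t ∈ Set.uIoo x₀ x₁, V t = D * Matrix.diagonal v * D.transpose)
    (hY : IsSolution V E x₀ x₁ Y dY) (hreg : IsUnit (dY x₀)) {t : ℝ} (ht : t ∈ uIcc x₀ x₁) :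
    psiD D Y dY t = valueMat (fun k => v k - E) (psiD D Y dY x₀) (t - x₀) *
        (derivMat (fun k => v k - E) (psiD D Y dY x₀) (t - x₀))⁻¹ ∧
      (IsUnit (dY t) ↔ IsUnit (derivMat (fun k => v k - E) (psiD D Y dY x₀) (t - x₀))) := by
  obtain ⟨h1, h2⟩ := hY.eq_mul hD hV hreg ht
  have hDu : IsUnit Dᵀ := by
    rw [transpose_eq_inv hD]
    exact Matrix.isUnit_nonsing_inv_iff.2 (isUnit_of_orthogonal hD)
  have hu : IsUnit (Dᵀ * dY x₀) := hDu.mul hreg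
  constructor
  · rw [psiD_eq hD Y dY t, h1, h2, Matrix.mul_inv_rev, mul_assoc, ← mul_assoc (Dᵀ * dY x₀),
      Matrix.mul_nonsing_inv _ ((Matrix.isUnit_iff_isUnit_det _).1 hu), one_mul]
  · have e1 : IsUnit (Dᵀ * dY t) ↔ IsUnit (dY t) := by
      obtain ⟨u, hu⟩ := hDu
      rw [← hu]; exact Units.isUnit_units_mul u _
    rw [← e1, h2]
    obtain ⟨u, hu⟩ := hu
    rw [← hu]; exact Units.isUnit_mul_units _ u

/-! ### The phase-sum identity and the theorem -/

/-- Along the homotopy the phases cross no multiple of `π`. -/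
lemma sum_floor_homotopy_eq {q : Fin n → ℝ} {P : Matrix (Fin n) (Fin n) ℝ} (hP : P.IsSymm)
    {α : ℝ × ℝ → Fin n → ℝ} (hc : Continuous α)
    (hα : ∀ t, HasPhases (homotopyDeriv q P t) (homotopyValue q P t) (α t)) (δ : ℝ) :
    ∑ j, ⌊α (δ, 0) j / Real.pi⌋ = ∑ j, ⌊α (δ, 1) j / Real.pi⌋ := by
  have hr : ∀ s : ℝ, Fintype.card {j // Real.sin (α (δ, s) j) ≠ 0} = (valueMat q P δ).rank := by
    intro s
    have hs : (homotopyDeriv q P (δ, s))ᵀ * homotopyValue q P (δ, s) =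
        (homotopyValue q P (δ, s))ᵀ * homotopyDeriv q P (δ, s) :=
      affineMat_transpose_mul (homotopy_wronskian q (δ, s)) hP
    obtain ⟨β, h1, h2⟩ := exists_hasPhases hs
      (detPlus_affineMat_ne_zero (homotopy_wronskian q (δ, s)) hP)
    rw [(hα (δ, s)).card_sin_ne_zero h1, h2, rank_homotopyValue]
  have hl := isLocallyConstant_sum_floor (α := fun s => α (δ, s)) (by fun_prop) hr
  exact hl.apply_eq_of_preconnectedSpace 0 1

/-- The identity between the phase sums. -/
lemma sum_phases_eq [NeZero n] {v : Fin n → ℝ} {E x₀ x₁ : ℝ} {P : Matrix (Fin n) (Fin n) ℝ}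
    (hP : P.IsSymm) {φ θ : ℝ → Fin n → ℝ} (hφ : ContinuousOn φ (uIcc x₀ x₁))
    (hφP : ∀ t ∈ uIcc x₀ x₁, IsUnit (derivMat (fun k => v k - E) P (t - x₀)) →
      HasPhases (derivMat (fun k => v k - E) P (t - x₀))
        (valueMat (fun k => v k - E) P (t - x₀)) (φ t))
    (hθ : IsFPhase v E x₀ x₁ θ) {x : ℝ} (hx : x ∈ uIcc x₀ x₁)
    (huo : IsUnit (omegaDen v E (x - x₀) P)) {ρ τ : Fin n → ℝ}
    (hρ : ∀ j, ρ j ∈ Ico 0 Real.pi) (hτ : ∀ j, τ j ∈ Ico 0 Real.pi)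
    (hρP : HasPhases (derivMat (fun k => v k - E) P (x - x₀))
        (valueMat (fun k => v k - E) P (x - x₀)) ρ)
    (hτP : EigenvaluesAreTan (omega v E (x - x₀) P) τ) :
    ∑ j, φ x j = ∑ j, φ x₀ j + ∑ j, θ x j + ∑ j, (ρ j - τ j) := by
  set q : Fin n → ℝ := fun k => v k - E with hq
  have hφ0 : HasPhases 1 P (φ x₀) := by
    have := hφP x₀ left_mem_uIcc (by simp)
    simpa using this
  have hstart : detPlus (homotopyDeriv q P (0, 0)) (homotopyValue q P (0, 0)) =
      detMinus (homotopyDeriv q P (0, 0)) (homotopyValue q P (0, 0)) *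
        expTwo (∑ j, φ x₀ j) := by
    rw [homotopyDeriv_zero_left, homotopyValue_zero_left]; exact hφ0.detPlus_eq
  obtain ⟨α, hc, hα, -, hα0⟩ := exists_continuous_phases (continuous_homotopyDeriv q P)
    (continuous_homotopyValue q P)
    (fun t => affineMat_transpose_mul (homotopy_wronskian q t) hP)
    (fun t => detPlus_affineMat_ne_zero (homotopy_wronskian q t) hP) (0, 0) hstart
  have hαs : Continuous fun t => ∑ j, α t j := by fun_prop
  -- Along `λ = 0` both sums are continuous, agree modulo `π` at the dense regular points, and
  -- coincide at `x₀`.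
  have h1 : ∑ j, φ x j = ∑ j, α (x - x₀, 0) j := by
    have h := sub_eq_sub_of_expTwo_eq (f := fun t => ∑ j, φ t j)
      (g := fun t => ∑ j, α (t - x₀, 0) j) (R := {t | IsUnit (derivMat q P (t - x₀))})
      isPreconnected_uIcc
      (uIcc_subset_closure_of_analytic (analyticAt_det_derivMat q P) (by simp)
        fun t _ ht => (Matrix.isUnit_iff_isUnit_det _).2 (isUnit_iff_ne_zero.2 ht))
      (by fun_prop) (by fun_prop) (fun t ht hu => ?_) hx left_mem_uIcc
    · simp only [sub_self, hα0] at h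
      linarith
    · have e1 := (hφP t ht hu).detPlus_eq
      have h2 := hα (t - x₀, 0)
      rw [homotopyDeriv_zero_right, homotopyValue_zero_right] at h2
      rw [h2.detPlus_eq] at e1
      exact (mul_left_cancel₀ h2.1 e1).symm
  -- On `δ = 0` the pair is constantly `(1, P)`, so the phase sum stays in one class modulo `π` and
  -- cannot vary.
  have h2 : ∑ j, α (0, 1) j = ∑ j, α (0, 0) j := by
    have h := sub_eq_sub_of_expTwo_eq (f := fun s : ℝ => ∑ j, α (0, s) j)
      (g := fun _ => ∑ j, α (0, 0) j) (R := univ) (J := univ)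
      isPreconnected_univ (by simp) (by fun_prop) (by fun_prop) (fun s _ _ => ?_)
      (mem_univ 1) (mem_univ 0)
    · linarith
    · have e1 := hα (0, s)
      rw [homotopyDeriv_zero_left, homotopyValue_zero_left] at e1
      have h3 := e1.detPlus_eq
      rw [hφ0.detPlus_eq, ← hα0] at h3
      exact (mul_left_cancel₀ hφ0.1 h3).symm
  -- Along `λ = 1` the addition theorem gives equality modulo `π` wherever `ξ` is invertible, a
  -- dense set; the value at `δ = 0` fixes the constant.
  have h3 : ∑ j, α (x - x₀, 1) j = ∑ j, θ x j + ∑ j, φ x₀ j := by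
    have hθc := hθ.1.continuousOn
    have hprod : ∀ t : ℝ, AnalyticAt ℝ (fun δ => ∏ k, cSol (q k) δ) t := fun t =>
      Finset.analyticAt_fun_prod _ fun k _ => analyticAt_cSol _ _
    have h := sub_eq_sub_of_expTwo_eq (f := fun t => ∑ j, α (t - x₀, 1) j)
      (g := fun t => ∑ j, θ t j + ∑ j, φ x₀ j) (R := {t | IsUnit (xiMat v E (t - x₀))})
      isPreconnected_uIcc
      (uIcc_subset_closure_of_analytic hprod (by simp)
        fun t _ ht => isUnit_xiMat_iff.2 fun k =>
          Finset.prod_ne_zero_iff.1 ht k (Finset.mem_univ k))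
      (by fun_prop) (by fun_prop) (fun t ht hu => ?_) hx left_mem_uIcc
    · simp only [sub_self, hθ.2, Finset.sum_const_zero, h2, hα0] at h
      linarith
    · rw [expTwo_add]
      exact expTwo_sum_homotopy_one (isUnit_xiMat_iff.1 hu) (hα (t - x₀, 1))
        (hθ.1.eigenvalues t ht hu) hφ0
  have hρα : HasPhases (derivMat q P (x - x₀)) (valueMat q P (x - x₀)) (α (x - x₀, 0)) := by
    have := hα (x - x₀, 0)
    rwa [homotopyDeriv_zero_right, homotopyValue_zero_right] at this
  have h4 := hρα.sum_sub_sum hρP hρ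
  have h5 := (hα (x - x₀, 1)).sum_sub_sum (hτP.hasPhases_homotopy_one huo) hτ
  rw [sum_floor_homotopy_eq hP hc hα] at h4
  rw [Finset.sum_sub_distrib]
  linarith

end CoupledChannel

end

theorem mainTheorem2 {n : ℕ}
    (V : ℝ → Matrix (Fin n) (Fin n) ℝ) (D : Matrix (Fin n) (Fin n) ℝ) (v : Fin n → ℝ)
    (E x₀ x₁ : ℝ) (Y dY : ℝ → Matrix (Fin n) (Fin n) ℝ)
    (hD : D ∈ Matrix.orthogonalGroup (Fin n) ℝ)
    (hV : ∀ t ∈ Set.uIoo x₀ x₁, V t = D * Matrix.diagonal v * D.transpose)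
    (hY : CoupledChannel.IsSolution V E x₀ x₁ Y dY)
    (hreg : IsUnit (dY x₀))
    (hsymm : (CoupledChannel.psi Y dY x₀).IsSymm) :
    -- the phase angles of `Ψᴰ` and of `δ ξ⁻¹ η₀` exist across the whole step
    (∀ φ₀ : Fin n → ℝ, CoupledChannel.AnglesOrdered φ₀ →
      CoupledChannel.EigenvaluesAreTan (CoupledChannel.psiD D Y dY x₀) φ₀ →
      ∃ φ, CoupledChannel.IsPsiPhase D Y dY x₀ x₁ φ ∧ φ x₀ = φ₀) ∧
    (∃ θ, CoupledChannel.IsFPhase v E x₀ x₁ θ) ∧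
    -- so do the normalized angles of `Ψᴰ(x)` and of `Ω(x)`, where these matrices are defined
    (∀ x ∈ Set.uIcc x₀ x₁, IsUnit (dY x) →
      ∃ ρ : Fin n → ℝ, (∀ j, ρ j ∈ Set.Ico 0 Real.pi) ∧
        CoupledChannel.EigenvaluesAreTan (CoupledChannel.psiD D Y dY x) ρ) ∧
    (∀ x ∈ Set.uIcc x₀ x₁,
      IsUnit (CoupledChannel.omegaDen v E (x - x₀) (CoupledChannel.psiD D Y dY x₀)) →
      ∃ τ : Fin n → ℝ, (∀ j, τ j ∈ Set.Ico 0 Real.pi) ∧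
        CoupledChannel.EigenvaluesAreTan
          (CoupledChannel.omega v E (x - x₀) (CoupledChannel.psiD D Y dY x₀)) τ) ∧
    -- the identity for the phase sums, and the count of multiples of `π` it gives
    (∀ φ θ : ℝ → Fin n → ℝ,
      CoupledChannel.IsPsiPhase D Y dY x₀ x₁ φ → CoupledChannel.IsFPhase v E x₀ x₁ θ →
      ∀ x ∈ Set.uIcc x₀ x₁, IsUnit (dY x) →
      IsUnit (CoupledChannel.omegaDen v E (x - x₀) (CoupledChannel.psiD D Y dY x₀)) →
      ∀ ρ τ : Fin n → ℝ,
      (∀ j, ρ j ∈ Set.Ico 0 Real.pi) → (∀ j, τ j ∈ Set.Ico 0 Real.pi) →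
      CoupledChannel.EigenvaluesAreTan (CoupledChannel.psiD D Y dY x) ρ →
      CoupledChannel.EigenvaluesAreTan
        (CoupledChannel.omega v E (x - x₀) (CoupledChannel.psiD D Y dY x₀)) τ →
      CoupledChannel.phaseSum φ x =
          CoupledChannel.phaseSum φ x₀ + CoupledChannel.phaseSum θ x + ∑ j, (ρ j - τ j) ∧
        ((∑ j, (⌊φ x j / Real.pi⌋ - ⌊φ x₀ j / Real.pi⌋) : ℤ) : ℝ) =
          (CoupledChannel.phaseSum φ x₀ + CoupledChannel.phaseSum θ x - ∑ j, τ j) / Real.pi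
            - ∑ j, (⌊φ x₀ j / Real.pi⌋ : ℝ)) := by
  have hP : (CoupledChannel.psiD D Y dY x₀).IsSymm := CoupledChannel.isSymm_psiD hD hsymm
  have hψ : ∀ t ∈ Set.uIcc x₀ x₁, _ := fun t ht =>
    CoupledChannel.IsSolution.psiD_eq_mul_inv hD hV hY hreg ht
  set P := CoupledChannel.psiD D Y dY x₀ with hPdef
  -- Without any angle the phase sum cannot be shifted by `π`, so the empty case is separate.
  rcases Nat.eq_zero_or_pos n with rfl | hn
  · have hE : ∀ (M : Matrix (Fin 0) (Fin 0) ℝ) (α : Fin 0 → ℝ),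
        CoupledChannel.EigenvaluesAreTan M α := fun M α => ⟨fun j => j.elim0, by simp⟩
    refine ⟨fun φ₀ _ _ => ⟨fun _ => φ₀, ⟨continuousOn_const, fun t _ => ⟨fun j => j.elim0,
      fun j => j.elim0⟩, fun t _ _ => hE _ _⟩, rfl⟩, ⟨fun _ _ => 0, ⟨continuousOn_const,
      fun t _ => ⟨fun j => j.elim0, fun j => j.elim0⟩, fun t _ _ => hE _ _⟩, fun j => rfl⟩,
      fun x _ _ => ⟨0, fun j => j.elim0, hE _ _⟩, fun x _ _ => ⟨0, fun j => j.elim0, hE _ _⟩, ?_⟩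
    intros
    simp [CoupledChannel.phaseSum]
  have : NeZero n := ⟨hn.ne'⟩
  refine ⟨fun φ₀ ho h0 => ?_, ?_, fun x hx hu => ?_, fun x hx hu =>
    CoupledChannel.exists_eigenvaluesAreTan_omega hP hu, ?_⟩
  · obtain ⟨φ, h1, h2, h3, h4⟩ :=
      CoupledChannel.exists_phases_of_symm (fun k => v k - E) hP ho h0
    refine ⟨fun t => φ (t - x₀), ⟨by fun_prop, fun t _ => h3 _, fun t ht hu => ?_⟩, by simpa⟩
    rw [(hψ t ht).1]
    exact (h2 _).eigenvaluesAreTan (CoupledChannel.derivMat_transpose_mul _ hP _)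
      ((hψ t ht).2.1 hu)
  · have hz : CoupledChannel.EigenvaluesAreTan (0 : Matrix (Fin n) (Fin n) ℝ) fun _ => 0 :=
      ⟨fun j => by simp, by simp⟩
    obtain ⟨θ, h1, h2, h3, h4⟩ := CoupledChannel.exists_phases_of_symm (fun k => v k - E)
      Matrix.isSymm_zero ⟨monotone_const, fun j k => by simpa using Real.pi_pos.le⟩ hz
    refine ⟨fun t => θ (t - x₀), ⟨by fun_prop, fun t _ => h3 _, fun t ht hu => ?_⟩, by simp [h4]⟩
    rw [← CoupledChannel.valueMat_mul_inv_zero_right hu]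
    refine (h2 _).eigenvaluesAreTan
      (CoupledChannel.derivMat_transpose_mul _ Matrix.isSymm_zero _) ?_
    rwa [CoupledChannel.derivMat_zero_right]
  · rw [(hψ x hx).1]
    exact CoupledChannel.exists_eigenvaluesAreTan (CoupledChannel.isSymm_mul_inv
      (CoupledChannel.derivMat_transpose_mul _ hP _) ((hψ x hx).2.1 hu))
  · intro φ θ hφ hθ x hx hu huo ρ τ hρ hτ hρP hτP
    have hφP : ∀ t ∈ Set.uIcc x₀ x₁,
        IsUnit (CoupledChannel.derivMat (fun k => v k - E) P (t - x₀)) →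
        CoupledChannel.HasPhases (CoupledChannel.derivMat (fun k => v k - E) P (t - x₀))
          (CoupledChannel.valueMat (fun k => v k - E) P (t - x₀)) (φ t) := fun t ht hut => by
      have := hφ.eigenvalues t ht ((hψ t ht).2.2 hut)
      rw [(hψ t ht).1] at this
      exact this.hasPhases_of_mul_inv hut
    have hux := (hψ x hx).2.1 hu
    rw [(hψ x hx).1] at hρP
    have hρH := hρP.hasPhases_of_mul_inv hux
    have hsum := CoupledChannel.sum_phases_eq hP hφ.continuousOn hφP hθ hx huo hρ hτ hρH hτP
    refine ⟨hsum, ?_⟩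
    have hfl := (hφP x hx hux).sum_sub_sum hρH hρ
    rw [Finset.sum_sub_distrib] at hsum
    simp only [CoupledChannel.phaseSum]
    have hpi := Real.pi_pos
    -- `π` times the floor sum is `∑ φ x j - ∑ ρ j`, so the `ρ` terms cancel in the identity.
    have e : (((∑ j, ⌊φ x j / Real.pi⌋ : ℤ)) : ℝ) =
        (∑ j, φ x₀ j + ∑ j, θ x j - ∑ j, τ j) / Real.pi := by
      rw [eq_div_iff hpi.ne']; linarith
    rw [← e, Finset.sum_sub_distrib]
    push_cast
    rfl
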